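/- Let $0\le\alpha<\frac{\pi}{2}$ and $0<t<1$, and let $A,B$ be complex $n\times n$ matrices that are sectorial with angle $\alpha$, that is, $\Re\langle Ax,x\rangle>0$ and $|\Im\langle Ax,x\rangle|\le(\tan\alpha)\,\Re\langle Ax,x\rangle$ for all unit vectors $x\in\mathbb C^n$, and likewise for $B$. Write $\Re X=\frac{X+X^*}{2}$ for a matrix $X$, and let $\le$ be the Loewner order on Hermitian matrices. For a function $f$ analytic on $\mathbb C\setminus(-\infty,0]$ and a matrix $X$ whose spectrum avoids $(-\infty,0]$, let $f(X)=\frac1{2\pi i}\oint_C f(z)(zI-X)^{-1}\,dz$, where $C$ is a positively oriented simple closed curve in $\mathbb C\setminus(-\infty,0]$ surrounding the spectrum of $X$, and let $$A\sigma_fB=A^{1/2}f\big(A^{-1/2}BA^{-1/2}\big)A^{1/2}.$$ Put $A\nabla_tB=(1-t)A+tB$ and $A!_tB=\big((1-t)A^{-1}+tB^{-1}\big)^{-1}$; let $A\sharp_pB=A\sigma_fB$ with $f(z)=z^p$ (principal branch) for $0\le p\le1$; and let $A\ell_tB=A\sigma_{\ell_t}B$, where $$\ell_t(x)=\frac{1-t}{t}\,\frac{x^t-1}{\log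 x}+\frac{t}{1-t}\,\frac{x-x^t}{\log x}\quad(x>0,\ x\ne1),\qquad \ell_t(1)=1,$$ is extended to $\mathbb C\setminus(-\infty,0]$ by the same formula with principal branches. Then: 1. $\ell_t$ maps $(0,\infty)$ to $(0,\infty)$ and is matrix monotone: for positive definite complex matrices $P\le Q$ of any size, $\ell_t(P)\le\ell_t(Q)$. Moreover $\ell_t(1)=1$, and $\ell_t$ is differentiable at $1$ with $\ell_t'(1)=t$. 2. $\displaystyle A\ell_tB=\frac{1-t}{t}\int_0^tA\sharp_pB\,dp+\frac{t}{1-t}\int_t^1A\sharp_pB\,dp.$ 3. $\cos^2\alpha\;\Re(A!_tB)+\Re(A\sharp_tB)-\sec^2\alpha\;\Re(A\nabla_tB)\ \le\ \Re(A\ell_tB)\ \le\ \sec^2\alpha\;\Re(A\nabla_tB)+\Re(A\sharp_tB)-\cos^2\alpha\;\Re(A!_tB).$ -/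

import Mathlib

open scoped ComplexOrder MatrixOrder

noncomputable section

namespace SectorialMean

/-- The real part `(A + A*) / 2` of a complex square matrix (Mathlib's `realPart`, seen as a
matrix). -/
def matRe {n : ℕ} (A : Matrix (Fin n) (Fin n) ℂ) : Matrix (Fin n) (Fin n) ℂ :=
  (realPart A : Matrix (Fin n) (Fin n) ℂ)

/-- `A` is sectorial with angle `α`: every value `⟨A x, x⟩ = x* A x` with `‖x‖ = 1` lies in
`{z | 0 < Re z, |Im z| ≤ tan α * Re z}`. (Mathlib's inner product is conjugate linear in the
first variable.) -/
def IsSectorial {n : ℕ} (α : ℝ) (A : Matrix (Fin n) (Fin n) ℂ) : Prop :=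
  ∀ x : EuclideanSpace ℂ (Fin n), ‖x‖ = 1 →
    0 < (inner ℂ x (Matrix.toEuclideanLin A x)).re ∧
    |(inner ℂ x (Matrix.toEuclideanLin A x)).im| ≤
      Real.tan α * (inner ℂ x (Matrix.toEuclideanLin A x)).re

/-- The contour integral `∮ g(z) dz` along the positively oriented boundary of the annular sector
`{z | r < |z| < R, |arg z| < θ}`: the outer arc, the upper segment (inwards), the inner arc
(clockwise) and the lower segment (outwards). For `0 < r < R` and `0 < θ < π` this is a simple
closed curve in the plane cut along `(-∞, 0]`. -/
def sectorIntegral (r R θ : ℝ) (g : ℂ → ℂ) : ℂ :=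
  (∫ φ in (-θ)..θ, g (R * Complex.exp (φ * Complex.I)) *
      (Complex.I * R * Complex.exp (φ * Complex.I)))
  - (∫ ρ in r..R, g (ρ * Complex.exp (θ * Complex.I)) * Complex.exp (θ * Complex.I))
  - (∫ φ in (-θ)..θ, g (r * Complex.exp (φ * Complex.I)) *
      (Complex.I * r * Complex.exp (φ * Complex.I)))
  + (∫ ρ in r..R, g (ρ * Complex.exp (-θ * Complex.I)) * Complex.exp (-θ * Complex.I))

/-- The boundary of the annular sector with parameters `(r, R, θ)` surrounds the spectrum of `A`
and stays away from `(-∞, 0]`. -/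
def SurroundsSpectrum {n : ℕ} (A : Matrix (Fin n) (Fin n) ℂ) (r R θ : ℝ) : Prop :=
  0 < r ∧ r < R ∧ 0 < θ ∧ θ < Real.pi ∧
    ∀ z ∈ spectrum ℂ A, r < ‖z‖ ∧ ‖z‖ < R ∧ |z.arg| < θ

/-- The Cauchy integral `(2πi)⁻¹ ∮ f(z) (z I - A)⁻¹ dz`, entry by entry. -/
def cauchyIntegral {n : ℕ} (f : ℂ → ℂ) (A : Matrix (Fin n) (Fin n) ℂ) (r R θ : ℝ) :
    Matrix (Fin n) (Fin n) ℂ :=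
  Matrix.of fun i j => (2 * Real.pi * Complex.I)⁻¹ *
    sectorIntegral r R θ fun z => f z * (z • (1 : Matrix (Fin n) (Fin n) ℂ) - A)⁻¹ i j

open Classical in
/-- The matrix `f(A)` for `f` analytic on the plane cut along `(-∞, 0]` and `A` a matrix whose
spectrum avoids `(-∞, 0]`: the Cauchy integral along a simple closed curve in the cut plane that
surrounds the spectrum. (By Cauchy's theorem the choice of the curve does not matter; one exists
exactly when the spectrum avoids `(-∞, 0]`, and otherwise the value is the default `0`.) -/
def matFun {n : ℕ} (f : ℂ → ℂ) (A : Matrix (Fin n) (Fin n) ℂ) : Matrix (Fin n) (Fin n) ℂ :=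
  if h : ∃ p : ℝ × ℝ × ℝ, SurroundsSpectrum A p.1 p.2.1 p.2.2 then
    cauchyIntegral f A h.choose.1 h.choose.2.1 h.choose.2.2
  else 0

/-- The principal square root `A^(1/2)`. -/
def matSqrt {n : ℕ} (A : Matrix (Fin n) (Fin n) ℂ) : Matrix (Fin n) (Fin n) ℂ :=
  matFun (fun z => z ^ (1 / 2 : ℂ)) A

/-- The mean `A σ_f B = A^(1/2) f(A^(-1/2) B A^(-1/2)) A^(1/2)`. -/
def mean {n : ℕ} (f : ℂ → ℂ) (A B : Matrix (Fin n) (Fin n) ℂ) : Matrix (Fin n) (Fin n) ℂ :=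
  matSqrt A * matFun f ((matSqrt A)⁻¹ * B * (matSqrt A)⁻¹) * matSqrt A

/-- The weighted geometric mean `A ♯_p B`, the mean with representing function `z ↦ z ^ p`
(principal branch). -/
def geomMean {n : ℕ} (p : ℝ) (A B : Matrix (Fin n) (Fin n) ℂ) : Matrix (Fin n) (Fin n) ℂ :=
  mean (fun z => z ^ (p : ℂ)) A B

/-- The weighted arithmetic mean `A ∇_t B`. -/
def arithMean {n : ℕ} (t : ℝ) (A B : Matrix (Fin n) (Fin n) ℂ) : Matrix (Fin n) (Fin n) ℂ :=
  (1 - t) • A + t • B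

/-- The weighted harmonic mean `A !_t B`. -/
def harmMean {n : ℕ} (t : ℝ) (A B : Matrix (Fin n) (Fin n) ℂ) : Matrix (Fin n) (Fin n) ℂ :=
  ((1 - t) • A⁻¹ + t • B⁻¹)⁻¹

/-- The representing function of the weighted logarithmic mean on `(0, ∞)`, with its limit value
`1` at `x = 1`. -/
def logFun (t x : ℝ) : ℝ :=
  if x = 1 then 1 else
    (1 - t) / t * ((x ^ t - 1) / Real.log x) + t / (1 - t) * ((x - x ^ t) / Real.log x)

/-- The analytic continuation of `logFun t` to the plane cut along `(-∞, 0]` (principal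
branches). -/
def logFunC (t : ℝ) (z : ℂ) : ℂ :=
  if z = 1 then 1 else
    (1 - t) / t * ((z ^ (t : ℂ) - 1) / Complex.log z)
      + t / (1 - t) * ((z - z ^ (t : ℂ)) / Complex.log z)

theorem logFunC_ofReal (t : ℝ) {x : ℝ} (hx : 0 < x) : logFunC t x = logFun t x := by
  unfold logFunC logFun
  by_cases h : x = 1
  · simp [h]
  · have h' : (x : ℂ) ≠ 1 := by exact_mod_cast h
    rw [if_neg h, if_neg h']
    push_cast [Complex.ofReal_cpow hx.le, Complex.ofReal_log hx.le]
    rfl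

/-- The weighted logarithmic mean `A ℓ_t B`, the mean with representing function `ℓ_t`. -/
def logMean {n : ℕ} (t : ℝ) (A B : Matrix (Fin n) (Fin n) ℂ) : Matrix (Fin n) (Fin n) ℂ :=
  mean (logFunC t) A B

/-- The class of functions `f : (0, ∞) → (0, ∞)` that are matrix monotone (in every size) with
`f 1 = 1`; only the values of `f` on `(0, ∞)` matter. For Hermitian matrices, `cfc f A` is
`U diag(f(λᵢ)) U*`. -/
def IsNormalizedMonotone (f : ℝ → ℝ) : Prop :=
  (∀ x : ℝ, 0 < x → 0 < f x) ∧ f 1 = 1 ∧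
    ∀ (k : ℕ) (A B : Matrix (Fin k) (Fin k) ℂ), A.PosDef → B.PosDef → A ≤ B →
      cfc f A ≤ cfc f B

end SectorialMean

end

noncomputable section

namespace SectorialMean

open Complex Set MeasureTheory

/-! ### Integrals along the boundary of a rectangle -/

/-! Every mean in the statement is an average of weighted harmonic means, and the bounds for
harmonic means are affine in the weight, so after averaging only the barycentre of the measure
matters.

Conjugating by `A^(1/2)` gives `A σ_f B = A f(A⁻¹B)` (`mean_eq`), and the function `z / ((1 - s) z +
s)` gives the harmonic mean `A !_s B` (`mean_harm`). For `0 < p < 1`, `z ^ p` is an average of these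
functions over a probability measure on `[0, 1]` with mean `p` (`exists_measure_cpow`). In turn
`ℓ_t(z)` is the average of `z ^ p` over `expMeasure t`, a probability measure with mean `t`
(`logFunC_eq_integral`, `integral_id_expMeasure`). By Fubini such averages pass through the contour
integral (`mean_integral`); this gives the integral formula. Monotonicity of `ℓ_t` is the averaged
Löwner–Heinz inequality, and `ℓ_t'(1)` is the mean of `expMeasure t`.

For the bounds, put `τ = tan α`. The sector condition yields `2 Re⟨Ku,y⟩ ≤ (1 + τ²) Re⟨Ku,u⟩ +
Re⟨Ky,y⟩` (`IsSectorialForm.two_re_le`). It bounds `Re⟨(A !_s B)x,x⟩` above by `sec² α` times the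
affine interpolation between `A` and `B`, and bounds `sec² α Re⟨(A !_s B)x,x⟩` below by an affine
function of `s` that equals `Re⟨(A !_t B)x,x⟩` at `s = t`. Averaging once gives `cos² α Re(A !_t B)
≤ Re(A σ B) ≤ sec² α Re(A ∇_t B)` for `σ = ♯_t`, averaging twice for `σ = ℓ_t`. Each final
inequality adds one half of this for `ℓ_t` to the opposite half for `♯_t`.

The functional calculus is built from Cauchy's theorem on rectangles through `z = exp w`; by
Cayley–Hamilton each `f(X)` is a polynomial in `X` (`cauchyIntegral_eq_aeval`), which also makes it
independent of the contour. -/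

/-- The integral of `f` along the positively oriented boundary of `[a, b] × [c, d]`. -/
def rectIntegral (a b c d : ℝ) (f : ℂ → ℂ) : ℂ :=
  (∫ x in a..b, f (x + c * I)) - (∫ x in a..b, f (x + d * I))
    + I * (∫ y in c..d, f (b + y * I)) - I * (∫ y in c..d, f (a + y * I))

theorem rectIntegral_eq_zero {a b c d : ℝ} {f : ℂ → ℂ}
    (hf : DifferentiableOn ℂ f (uIcc a b ×ℂ uIcc c d)) : rectIntegral a b c d f = 0 := by
  have := integral_boundary_rect_eq_zero_of_differentiableOn f (a + c * I) (b + d * I)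
    (by simpa using hf)
  simpa [rectIntegral] using this

theorem hasDerivAt_horizontal (c : ℝ) (x : ℝ) :
    HasDerivAt (fun x : ℝ => (x : ℂ) + c * I) 1 x :=
  (hasDerivAt_id (x : ℂ)).comp_ofReal.add_const _

theorem hasDerivAt_vertical (a : ℝ) (y : ℝ) :
    HasDerivAt (fun y : ℝ => (a : ℂ) + y * I) I y := by
  simpa using ((hasDerivAt_id (y : ℂ)).comp_ofReal.mul_const I).const_add (a : ℂ)

theorem integral_horizontal {a b c : ℝ} {F f : ℂ → ℂ}
    (hF : ∀ x ∈ uIcc a b, HasDerivAt F (f (x + c * I)) (x + c * I))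
    (hf : ContinuousOn (fun x : ℝ => f (x + c * I)) (uIcc a b)) :
    ∫ x in a..b, f (x + c * I) = F (b + c * I) - F (a + c * I) := by
  refine intervalIntegral.integral_eq_sub_of_hasDerivAt (f := fun x : ℝ => F (x + c * I))
    (fun x hx => ?_) hf.intervalIntegrable
  have := (hF x hx).comp x (hasDerivAt_horizontal c x)
  rw [mul_one] at this
  exact this

theorem integral_vertical {a c d : ℝ} {F f : ℂ → ℂ}
    (hF : ∀ y ∈ uIcc c d, HasDerivAt F (f (a + y * I)) (a + y * I))
    (hf : ContinuousOn (fun y : ℝ => f (a + y * I)) (uIcc c d)) :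
    I * (∫ y in c..d, f (a + y * I)) = F (a + d * I) - F (a + c * I) := by
  rw [← intervalIntegral.integral_const_mul]
  refine intervalIntegral.integral_eq_sub_of_hasDerivAt (f := fun y : ℝ => F (a + y * I))
    (fun y hy => ?_) (hf.const_smul I).intervalIntegrable
  have := (hF y hy).comp y (hasDerivAt_vertical a y)
  rw [mul_comm] at this
  exact this

theorem log_I_mul {w : ℂ} (hw : 0 < w.re) : log (I * w) = log w + Real.pi / 2 * I := by
  have h0 : w ≠ 0 := fun h => by simp [h] at hw
  have := abs_lt.1 (abs_arg_lt_pi_div_two_iff.2 (Or.inl hw))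
  rw [(log_mul_eq_add_log_iff I_ne_zero h0).2, log_I, add_comm]
  rw [arg_I]
  constructor <;> linarith [Real.pi_pos]

theorem hasDerivAt_log_mul {k c w : ℂ} (h : 0 < (k * (w - c)).re) :
    HasDerivAt (fun w => log (k * (w - c))) (w - c)⁻¹ w := by
  have hk : k ≠ 0 := by rintro rfl; simp at h
  have hw : w - c ≠ 0 := fun h0 => by simp [h0] at h
  have := (((hasDerivAt_id' w).sub_const c).const_mul k).clog (Or.inl h)
  convert this using 1
  field_simp

/-- Each side gets its own branch of the logarithm: `z - w` is rotated by `I`, `-I`, `1` or `-1`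
into the right half plane. The branches of adjacent sides differ by `π/2 * I` at the common corner,
and the four jumps add up to `2πi`. -/
theorem rectIntegral_inv_sub {a b c d : ℝ} {w : ℂ} (ha : a < w.re) (hb : w.re < b)
    (hc : c < w.im) (hd : w.im < d) :
    rectIntegral a b c d (fun z => (z - w)⁻¹) = 2 * Real.pi * I := by
  have hcont : ∀ (g : ℝ → ℂ) (s : Set ℝ), Continuous g → (∀ x ∈ s, g x - w ≠ 0) →
      ContinuousOn (fun x => (g x - w)⁻¹) s := fun g s hg h =>
    (hg.sub continuous_const).continuousOn.inv₀ h
  have hh : ∀ y : ℝ, Continuous fun x : ℝ => (x : ℂ) + y * I := fun y => by fun_prop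
  have hv : ∀ x : ℝ, Continuous fun y : ℝ => (x : ℂ) + y * I := fun y => by fun_prop
  have e1 := integral_horizontal (a := a) (b := b) (c := c)
    (F := fun z => log (I * (z - w))) (f := fun z => (z - w)⁻¹)
    (fun x hx => hasDerivAt_log_mul (by simpa using hc))
    (hcont _ _ (hh c) fun x _ h => by
      have := congrArg im h; simp at this; linarith)
  have e2 := integral_horizontal (a := a) (b := b) (c := d)
    (F := fun z => log (-I * (z - w))) (f := fun z => (z - w)⁻¹)
    (fun x hx => hasDerivAt_log_mul (by simpa using hd))
    (hcont _ _ (hh d) fun x _ h => by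
      have := congrArg im h; simp at this; linarith)
  have e3 := integral_vertical (a := b) (c := c) (d := d)
    (F := fun z => log (1 * (z - w))) (f := fun z => (z - w)⁻¹)
    (fun x hx => hasDerivAt_log_mul (by simpa using hb))
    (hcont _ _ (hv b) fun x _ h => by
      have := congrArg re h; simp at this; linarith)
  have e4 := integral_vertical (a := a) (c := c) (d := d)
    (F := fun z => log (-1 * (z - w))) (f := fun z => (z - w)⁻¹)
    (fun x hx => hasDerivAt_log_mul (by simpa using ha))
    (hcont _ _ (hv a) fun x _ h => by
      have := congrArg re h; simp at this; linarith)
  unfold rectIntegral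
  rw [e1, e2, e3, e4]
  have c1 := log_I_mul (w := b + c * I - w) (by simpa using hb)
  have c2 := log_I_mul (w := -I * (b + d * I - w)) (by simpa using hd)
  have c3 := log_I_mul (w := -1 * (a + d * I - w)) (by simpa using ha)
  have c4 := log_I_mul (w := I * (a + c * I - w)) (by simpa using hc)
  have s2 : I * (-I * (b + d * I - w)) = 1 * (b + d * I - w) := by
    linear_combination (-(b + d * I - w)) * I_mul_I
  have s3 : I * (-1 * (a + d * I - w)) = -I * (a + d * I - w) := by ring
  have s4 : I * (I * (a + c * I - w)) = -1 * (a + c * I - w) := by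
    linear_combination (a + c * I - w) * I_mul_I
  rw [s2] at c2
  rw [s3] at c3
  rw [s4] at c4
  rw [c1, c2, c3, c4, one_mul]
  ring

/-! ### Contour integrals along the boundary of an annular sector -/

/-- The parameters of an annular sector in the plane cut along `(-∞, 0]`. -/
structure IsSector (r R θ : ℝ) : Prop where
  pos : 0 < r
  lt : r < R
  angle_pos : 0 < θ
  angle_lt : θ < Real.pi

/-- The boundary of the annular sector with parameters `(r, R, θ)`. -/
def sectorBoundary (r R θ : ℝ) : Set ℂ :=
  {z | ∃ ρ φ : ℝ, z = ρ * exp (φ * I) ∧ ρ ∈ Icc r R ∧ φ ∈ Icc (-θ) θ ∧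
    (ρ = r ∨ ρ = R ∨ φ = θ ∨ φ = -θ)}

section

variable {r R θ : ℝ} (h : IsSector r R θ)
include h

theorem IsSector.norm_arg {ρ φ : ℝ} (hρ : ρ ∈ Icc r R) (hφ : φ ∈ Icc (-θ) θ) :
    ‖(ρ * exp (φ * I) : ℂ)‖ = ρ ∧ arg (ρ * exp (φ * I)) = φ := by
  have hρ0 : 0 < ρ := h.pos.trans_le hρ.1
  have := h.angle_lt
  refine ⟨by simp [abs_of_pos hρ0], ?_⟩
  rw [exp_mul_I]
  exact arg_mul_cos_add_sin_mul_I hρ0 ⟨by linarith [hφ.1], by linarith [hφ.2]⟩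

theorem IsSector.boundary_subset : sectorBoundary r R θ ⊆ slitPlane := by
  rintro z ⟨ρ, φ, rfl, hρ, hφ, -⟩
  have hn := h.norm_arg hρ hφ
  rw [mem_slitPlane_iff_arg, hn.2, ← norm_pos_iff, hn.1]
  exact ⟨by linarith [hφ.2, h.angle_lt], h.pos.trans_le hρ.1⟩

theorem IsSector.sub_ne_zero {z a : ℂ} (hz : z ∈ sectorBoundary r R θ)
    (h1 : r < ‖a‖) (h2 : ‖a‖ < R) (h3 : |a.arg| < θ) : z - a ≠ 0 := by
  obtain ⟨ρ, φ, rfl, hρ, hφ, hh⟩ := hz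
  have hn := h.norm_arg hρ hφ
  intro he
  rw [_root_.sub_eq_zero] at he
  rw [he] at hn
  rw [hn.1] at h1 h2
  rw [hn.2, abs_lt] at h3
  rcases hh with hh | hh | hh | hh <;> subst hh <;> linarith

theorem IsSector.outer_mem {φ : ℝ} (hφ : φ ∈ Icc (-θ) θ) :
    (R * exp (φ * I) : ℂ) ∈ sectorBoundary r R θ :=
  ⟨R, φ, rfl, ⟨h.lt.le, le_rfl⟩, hφ, by simp⟩

theorem IsSector.inner_mem {φ : ℝ} (hφ : φ ∈ Icc (-θ) θ) :
    (r * exp (φ * I) : ℂ) ∈ sectorBoundary r R θ :=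
  ⟨r, φ, rfl, ⟨le_rfl, h.lt.le⟩, hφ, by simp⟩

theorem IsSector.upper_mem {ρ : ℝ} (hρ : ρ ∈ Icc r R) :
    (ρ * exp (θ * I) : ℂ) ∈ sectorBoundary r R θ :=
  ⟨ρ, θ, rfl, hρ, ⟨by linarith [h.angle_pos], le_rfl⟩, by simp⟩

theorem IsSector.lower_mem {ρ : ℝ} (hρ : ρ ∈ Icc r R) :
    (ρ * exp (-θ * I) : ℂ) ∈ sectorBoundary r R θ :=
  ⟨ρ, -θ, by simp, hρ, ⟨le_rfl, by linarith [h.angle_pos]⟩, by simp⟩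

theorem IsSector.uIcc_angle : uIcc (-θ) θ = Icc (-θ) θ :=
  uIcc_of_le (by linarith [h.angle_pos])

theorem IsSector.uIcc_radius : uIcc r R = Icc r R := uIcc_of_le h.lt.le

theorem sectorIntegral_congr {f g : ℂ → ℂ} (hfg : EqOn f g (sectorBoundary r R θ)) :
    sectorIntegral r R θ f = sectorIntegral r R θ g := by
  unfold sectorIntegral
  congr 1
  · congr 1
    · congr 1
      · refine intervalIntegral.integral_congr fun φ hφ => ?_
        rw [h.uIcc_angle] at hφ
        simp only [hfg (h.outer_mem hφ)]
      · refine intervalIntegral.integral_congr fun φ hφ => ?_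
        rw [h.uIcc_radius] at hφ
        simp only [hfg (h.upper_mem hφ)]
    · refine intervalIntegral.integral_congr fun φ hφ => ?_
      rw [h.uIcc_angle] at hφ
      simp only [hfg (h.inner_mem hφ)]
  · refine intervalIntegral.integral_congr fun φ hφ => ?_
    rw [h.uIcc_radius] at hφ
    simp only [hfg (h.lower_mem hφ)]

theorem continuousOn_outer {f : ℂ → ℂ} (hf : ContinuousOn f (sectorBoundary r R θ)) :
    ContinuousOn (fun φ : ℝ => f (R * exp (φ * I)) * (I * R * exp (φ * I))) (uIcc (-θ) θ) := by
  rw [h.uIcc_angle]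
  refine ContinuousOn.mul (hf.comp (by fun_prop) fun φ hφ => h.outer_mem hφ) (by fun_prop)

theorem continuousOn_inner {f : ℂ → ℂ} (hf : ContinuousOn f (sectorBoundary r R θ)) :
    ContinuousOn (fun φ : ℝ => f (r * exp (φ * I)) * (I * r * exp (φ * I))) (uIcc (-θ) θ) := by
  rw [h.uIcc_angle]
  refine ContinuousOn.mul (hf.comp (by fun_prop) fun φ hφ => h.inner_mem hφ) (by fun_prop)

theorem continuousOn_upper {f : ℂ → ℂ} (hf : ContinuousOn f (sectorBoundary r R θ)) :
    ContinuousOn (fun ρ : ℝ => f (ρ * exp (θ * I)) * exp (θ * I)) (uIcc r R) := by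
  rw [h.uIcc_radius]
  refine ContinuousOn.mul (hf.comp (by fun_prop) fun φ hφ => h.upper_mem hφ) (by fun_prop)

theorem continuousOn_lower {f : ℂ → ℂ} (hf : ContinuousOn f (sectorBoundary r R θ)) :
    ContinuousOn (fun ρ : ℝ => f (ρ * exp (-θ * I)) * exp (-θ * I)) (uIcc r R) := by
  rw [h.uIcc_radius]
  refine ContinuousOn.mul (hf.comp (by fun_prop) fun φ hφ => h.lower_mem hφ) (by fun_prop)

theorem sectorIntegral_add {f g : ℂ → ℂ} (hf : ContinuousOn f (sectorBoundary r R θ))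
    (hg : ContinuousOn g (sectorBoundary r R θ)) :
    sectorIntegral r R θ (fun z => f z + g z)
      = sectorIntegral r R θ f + sectorIntegral r R θ g := by
  unfold sectorIntegral
  simp only [add_mul]
  rw [intervalIntegral.integral_add (continuousOn_outer h hf).intervalIntegrable
      (continuousOn_outer h hg).intervalIntegrable,
    intervalIntegral.integral_add (continuousOn_inner h hf).intervalIntegrable
      (continuousOn_inner h hg).intervalIntegrable,
    intervalIntegral.integral_add (continuousOn_upper h hf).intervalIntegrable
      (continuousOn_upper h hg).intervalIntegrable,
    intervalIntegral.integral_add (continuousOn_lower h hf).intervalIntegrable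
      (continuousOn_lower h hg).intervalIntegrable]
  ring

omit h in
theorem sectorIntegral_const_mul (c : ℂ) (f : ℂ → ℂ) :
    sectorIntegral r R θ (fun z => c * f z) = c * sectorIntegral r R θ f := by
  unfold sectorIntegral
  simp only [mul_assoc c, intervalIntegral.integral_const_mul]
  ring

theorem sectorIntegral_sum {ι : Type*} (s : Finset ι) {f : ι → ℂ → ℂ}
    (hf : ∀ i ∈ s, ContinuousOn (f i) (sectorBoundary r R θ)) :
    sectorIntegral r R θ (fun z => ∑ i ∈ s, f i z)
      = ∑ i ∈ s, sectorIntegral r R θ (f i) := by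
  classical
  induction s using Finset.induction_on with
  | empty => simp [sectorIntegral]
  | insert a s ha ih =>
    simp only [Finset.sum_insert ha]
    rw [sectorIntegral_add h (hf a (by simp))
      (continuousOn_finsetSum _ fun i hi => hf i (by simp [hi])),
      ih fun i hi => hf i (by simp [hi])]

/-- The substitution `z = exp w` turns the boundary of a sector into that of a rectangle. -/
theorem sectorIntegral_eq_rectIntegral {g : ℂ → ℂ}
    (hg : ContinuousOn g (sectorBoundary r R θ)) :
    sectorIntegral r R θ g =
      rectIntegral (Real.log r) (Real.log R) (-θ) θ (fun w => g (exp w) * exp w) := by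
  have hr := h.pos
  have hR : 0 < R := hr.trans h.lt
  have arc : ∀ ρ : ℝ, 0 < ρ → ∀ φ : ℝ,
      exp ((Real.log ρ : ℝ) + φ * I) = ρ * exp (φ * I) := fun ρ hρ φ => by
    rw [exp_add, ← ofReal_exp, Real.exp_log hρ]
  have him : Real.exp '' uIcc (Real.log r) (Real.log R) ⊆ Icc r R := by
    rintro _ ⟨x, hx, rfl⟩
    rw [uIcc_of_le (Real.log_le_log hr h.lt.le)] at hx
    exact ⟨(Real.log_le_iff_le_exp hr).1 hx.1, (Real.le_log_iff_exp_le hR).1 hx.2⟩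
  -- A complex `k` lets one statement serve both `θ` and `-θ`, the latter being a negated cast in
  -- `sectorIntegral`.
  have seg : ∀ k : ℂ, (∀ ρ ∈ Icc r R, (ρ * exp (k * I) : ℂ) ∈ sectorBoundary r R θ) →
      ∫ x in Real.log r..Real.log R, g (exp (x + k * I)) * exp (x + k * I)
        = ∫ ρ in r..R, g (ρ * exp (k * I)) * exp (k * I) := by
    intro k hk
    have := intervalIntegral.integral_deriv_smul_comp' (a := Real.log r) (b := Real.log R)
      (f := Real.exp) (f' := Real.exp) (g := fun ρ : ℝ => g (ρ * exp (k * I)) * exp (k * I))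
      (fun x _ => Real.hasDerivAt_exp x) Real.continuous_exp.continuousOn
      (ContinuousOn.mul (hg.comp (by fun_prop) fun ρ hρ => hk ρ (him hρ)) continuousOn_const)
    rw [Real.exp_log hr, Real.exp_log hR] at this
    rw [← this]
    refine intervalIntegral.integral_congr fun x _ => ?_
    simp only [Function.comp, exp_add, ofReal_exp, real_smul]
    ring
  have s1 := seg θ fun ρ hρ => h.upper_mem hρ
  have s2 := seg (-θ) fun ρ hρ => h.lower_mem hρ
  unfold sectorIntegral rectIntegral
  push_cast
  rw [s1, s2, ← intervalIntegral.integral_const_mul, ← intervalIntegral.integral_const_mul]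
  simp only [arc R hR, arc r hr]
  have c1 : ∀ ρ : ℝ, (fun φ : ℝ => g (ρ * exp (φ * I)) * (I * ρ * exp (φ * I))) =
      fun φ : ℝ => I * (g (ρ * exp (φ * I)) * (ρ * exp (φ * I))) := fun ρ => by
    ext φ; ring
  rw [c1 R, c1 r]
  ring

theorem IsSector.log_rect {z : ℂ} (hz : z ∈ uIcc (Real.log r) (Real.log R) ×ℂ uIcc (-θ) θ) :
    exp z ∈ slitPlane ∧ |z.im| < Real.pi := by
  have h1 := hz.2
  simp only [mem_preimage, h.uIcc_angle] at h1
  have hi : |z.im| < Real.pi := (abs_le.2 h1).trans_lt h.angle_lt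
  refine ⟨?_, hi⟩
  rw [mem_slitPlane_iff_arg]
  have : (exp z).arg = z.im := by
    rw [← log_im, log_exp] <;> linarith [abs_lt.1 hi]
  exact ⟨by rw [this]; exact ((abs_lt.1 hi).2).ne, exp_ne_zero _⟩

/-- Cauchy's theorem for the boundary of an annular sector in the cut plane. -/
theorem sectorIntegral_eq_zero {g : ℂ → ℂ} (hg : DifferentiableOn ℂ g slitPlane) :
    sectorIntegral r R θ g = 0 := by
  rw [sectorIntegral_eq_rectIntegral h (hg.continuousOn.mono h.boundary_subset)]
  refine rectIntegral_eq_zero (DifferentiableOn.mul ?_ differentiable_exp.differentiableOn)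
  exact hg.comp differentiable_exp.differentiableOn fun z hz => (h.log_rect hz).1

/-- A function with a primitive along the boundary of a sector integrates to zero. -/
theorem sectorIntegral_eq_zero_of_hasDerivAt {F g : ℂ → ℂ}
    (hg : ContinuousOn g (sectorBoundary r R θ))
    (hF : ∀ z ∈ sectorBoundary r R θ, HasDerivAt F (g z) z) :
    sectorIntegral r R θ g = 0 := by
  have hR : 0 < R := h.pos.trans h.lt
  have hexp : ∀ x y : ℝ, exp (x + y * I) = (Real.exp x : ℝ) * exp (y * I) := fun x y => by
    rw [exp_add, ofReal_exp]
  have hmem : ∀ x ∈ uIcc (Real.log r) (Real.log R), Real.exp x ∈ Icc r R := fun x hx => by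
    rw [uIcc_of_le (Real.log_le_log h.pos h.lt.le)] at hx
    exact ⟨(Real.log_le_iff_le_exp h.pos).1 hx.1, (Real.le_log_iff_exp_le hR).1 hx.2⟩
  have m1 : ∀ x ∈ uIcc (Real.log r) (Real.log R),
      exp (x + (-θ : ℝ) * I) ∈ sectorBoundary r R θ := fun x hx => by
    rw [hexp]; simpa using h.lower_mem (hmem x hx)
  have m2 : ∀ x ∈ uIcc (Real.log r) (Real.log R),
      exp (x + θ * I) ∈ sectorBoundary r R θ := fun x hx => by
    rw [hexp]; exact h.upper_mem (hmem x hx)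
  have m3 : ∀ y ∈ uIcc (-θ) θ, exp ((Real.log R : ℝ) + y * I) ∈ sectorBoundary r R θ :=
    fun y hy => by
    rw [hexp, Real.exp_log hR]; exact h.outer_mem (h.uIcc_angle ▸ hy)
  have m4 : ∀ y ∈ uIcc (-θ) θ, exp ((Real.log r : ℝ) + y * I) ∈ sectorBoundary r R θ :=
    fun y hy => by
    rw [hexp, Real.exp_log h.pos]; exact h.inner_mem (h.uIcc_angle ▸ hy)
  have hd : ∀ w, exp w ∈ sectorBoundary r R θ →
      HasDerivAt (fun w => F (exp w)) (g (exp w) * exp w) w := fun w hw =>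
    (hF _ hw).comp w (hasDerivAt_exp w)
  have hc : ∀ (γ : ℝ → ℂ) (s : Set ℝ), Continuous γ →
      (∀ x ∈ s, exp (γ x) ∈ sectorBoundary r R θ) →
      ContinuousOn (fun x => g (exp (γ x)) * exp (γ x)) s := fun γ s hγ hs =>
    (hg.comp (continuous_exp.comp hγ).continuousOn hs).mul
      (continuous_exp.comp hγ).continuousOn
  rw [sectorIntegral_eq_rectIntegral h hg]
  unfold rectIntegral
  rw [integral_horizontal (F := fun w => F (exp w)) (f := fun w => g (exp w) * exp w)
      (fun x hx => hd _ (m1 x hx)) (hc _ _ (by fun_prop) m1),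
    integral_horizontal (F := fun w => F (exp w)) (f := fun w => g (exp w) * exp w)
      (fun x hx => hd _ (m2 x hx)) (hc _ _ (by fun_prop) m2),
    integral_vertical (F := fun w => F (exp w)) (f := fun w => g (exp w) * exp w)
      (fun x hx => hd _ (m3 x hx)) (hc _ _ (by fun_prop) m3),
    integral_vertical (F := fun w => F (exp w)) (f := fun w => g (exp w) * exp w)
      (fun x hx => hd _ (m4 x hx)) (hc _ _ (by fun_prop) m4)]
  ring

theorem continuousOn_inv_sub {a : ℂ} (h1 : r < ‖a‖) (h2 : ‖a‖ < R) (h3 : |a.arg| < θ) :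
    ContinuousOn (fun z => (z - a)⁻¹) (sectorBoundary r R θ) :=
  (continuousOn_id.sub continuousOn_const).inv₀ fun _ hz => h.sub_ne_zero hz h1 h2 h3

/-- In the variable `w = log z` the integrand becomes `exp w / (exp w - a)`, with a simple pole of
residue 1 at `c = log a`. Subtracting `(w - c)⁻¹` leaves a function holomorphic on the rectangle, so
the value is that of `rectIntegral_inv_sub`. -/
theorem sectorIntegral_inv_sub {a : ℂ} (h1 : r < ‖a‖) (h2 : ‖a‖ < R) (h3 : |a.arg| < θ) :
    sectorIntegral r R θ (fun z => (z - a)⁻¹) = 2 * Real.pi * I := by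
  have ha0 : a ≠ 0 := norm_pos_iff.1 (h.pos.trans h1)
  set c := log a with hc
  have hac : exp c = a := exp_log ha0
  have hre1 : Real.log r < c.re := by
    rw [hc, log_re]; exact Real.log_lt_log h.pos h1
  have hre2 : c.re < Real.log R := by
    rw [hc, log_re]; exact Real.log_lt_log (norm_pos_iff.2 ha0) h2
  have him : -θ < c.im ∧ c.im < θ := by rw [hc, log_im]; exact abs_lt.1 h3
  set S := uIcc (Real.log r) (Real.log R) ×ℂ uIcc (-θ) θ with hS
  have hlogle := (hre1.trans hre2).le
  have hSc : S ∈ nhds c := by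
    rw [hS, uIcc_of_le hlogle, h.uIcc_angle]
    exact Filter.inter_mem (continuous_re.continuousAt.preimage_mem_nhds (Icc_mem_nhds hre1 hre2))
      (continuous_im.continuousAt.preimage_mem_nhds (Icc_mem_nhds him.1 him.2))
  have hcim : |c.im| < Real.pi := (abs_lt.2 him).trans h.angle_lt
  set E := dslope exp c with hE
  have hEd : DifferentiableOn ℂ E S :=
    (differentiableOn_dslope hSc).2 differentiable_exp.differentiableOn
  have hEmul : ∀ w, exp w - a = (w - c) * E w := fun w => by
    have := sub_smul_dslope exp c w
    rw [hac] at this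
    simpa using this.symm
  -- At `c` the quotient is `exp c`; elsewhere a zero would mean `exp w = exp c`, impossible because
  -- `exp` is injective on `|Im w| < π`.
  have hE0 : ∀ w ∈ S, E w ≠ 0 := by
    intro w hw h0
    by_cases hwc : w = c
    · rw [hE, hwc, dslope_same, Complex.deriv_exp] at h0
      exact exp_ne_zero _ h0
    · have h4 := hEmul w
      rw [h0, mul_zero, _root_.sub_eq_zero] at h4
      have h5 := (h.log_rect hw).2
      apply hwc
      rw [hc, ← h4, log_exp] <;> linarith [abs_lt.1 h5]
  -- The difference of the two integrands is `N w / ((w - c) E w)`, and `N c = 0` cancels the pole.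
  set N : ℂ → ℂ := fun w => exp w - E w with hN
  have hNc : N c = 0 := by simp [hN, hE]
  have hNd : DifferentiableOn ℂ (dslope N c) S :=
    (differentiableOn_dslope hSc).2 (differentiable_exp.differentiableOn.sub hEd)
  have hNmul : ∀ w, N w = (w - c) * dslope N c w := fun w => by
    have := sub_smul_dslope N c w
    rw [hNc] at this
    simpa using this.symm
  have hD : DifferentiableOn ℂ (fun w => dslope N c w / E w) S := hNd.div hEd hE0
  have key : ∀ w ∈ S, w ≠ c → (exp w - a)⁻¹ * exp w - (w - c)⁻¹ = dslope N c w / E w := by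
    intro w hw hwc
    have hw0 : w - c ≠ 0 := sub_ne_zero.2 hwc
    have hEw := hE0 w hw
    have := hNmul w
    simp only [hN] at this
    rw [hEmul w]
    field_simp
    linear_combination this
  rw [sectorIntegral_eq_rectIntegral h (continuousOn_inv_sub h h1 h2 h3)]
  have hz := rectIntegral_eq_zero hD
  rw [← rectIntegral_inv_sub hre1 hre2 him.1 him.2]
  have hm : ∀ x y : ℝ, x ∈ uIcc (Real.log r) (Real.log R) → y ∈ uIcc (-θ) θ →
      (x + y * I : ℂ) ∈ S := fun x y hx hy => by
    rw [hS, mem_reProdIm]; simpa using ⟨hx, hy⟩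
  have hli : ∀ (γ : ℝ → ℂ) (u v : ℝ), Continuous γ → (∀ x ∈ uIcc u v, γ x ∈ S) →
      (∀ x ∈ uIcc u v, γ x ≠ c) →
      ∫ x in u..v, (exp (γ x) - a)⁻¹ * exp (γ x) =
        (∫ x in u..v, dslope N c (γ x) / E (γ x)) + ∫ x in u..v, (γ x - c)⁻¹ := by
    intro γ u v hγ hs hne
    rw [← intervalIntegral.integral_add]
    · refine intervalIntegral.integral_congr fun x hx => ?_
      simp only [← key _ (hs x hx) (hne x hx)]
      ring
    · exact (hD.continuousOn.comp hγ.continuousOn hs).intervalIntegrable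
    · exact ((hγ.sub continuous_const).continuousOn.inv₀
        fun x hx => sub_ne_zero.2 (hne x hx)).intervalIntegrable
  have hθ : -θ ≤ θ := by linarith [h.angle_pos]
  unfold rectIntegral at hz ⊢
  rw [hli _ _ _ (by fun_prop) (fun x hx => hm x _ hx left_mem_uIcc)
      (fun x _ he => by have := congrArg im he; simp at this; linarith),
    hli _ _ _ (by fun_prop) (fun x hx => hm x _ hx right_mem_uIcc)
      (fun x _ he => by have := congrArg im he; simp at this; linarith),
    hli _ _ _ (by fun_prop) (fun x hx => hm _ x right_mem_uIcc hx)
      (fun x _ he => by have := congrArg re he; simp at this; linarith),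
    hli _ _ _ (by fun_prop) (fun x hx => hm _ x left_mem_uIcc hx)
      (fun x _ he => by have := congrArg re he; simp at this; linarith)]
  linear_combination hz

theorem sectorIntegral_inv_sub_pow {a : ℂ} (h1 : r < ‖a‖) (h2 : ‖a‖ < R) (h3 : |a.arg| < θ)
    (k : ℕ) : sectorIntegral r R θ (fun z => ((z - a)⁻¹) ^ (k + 1 + 1)) = 0 := by
  refine sectorIntegral_eq_zero_of_hasDerivAt h
    (F := fun z => -((k + 1 : ℕ) : ℂ)⁻¹ * ((z - a)⁻¹) ^ (k + 1))
    ((continuousOn_inv_sub h h1 h2 h3).pow _) fun z hz => ?_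
  have h0 := h.sub_ne_zero hz h1 h2 h3
  have := (((((hasDerivAt_id' z).sub_const a).fun_inv h0).fun_pow (k + 1)).const_mul
    (-((k + 1 : ℕ) : ℂ)⁻¹))
  have hk : ((k + 1 : ℕ) : ℂ) ≠ 0 := by exact_mod_cast k.succ_ne_zero
  refine this.congr_deriv ?_
  rw [Nat.add_sub_cancel]
  generalize ((k + 1 : ℕ) : ℂ) = m at hk
  rw [inv_pow, inv_pow]
  field_simp
  ring

end

/-! ### The holomorphic functional calculus of a matrix -/

section

variable {n : ℕ} {X : Matrix (Fin n) (Fin n) ℂ} {r R θ : ℝ}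

theorem SurroundsSpectrum.isSector (h : SurroundsSpectrum X r R θ) : IsSector r R θ :=
  ⟨h.1, h.2.1, h.2.2.1, h.2.2.2.1⟩

theorem isUnit_det_of_notMem_spectrum {z : ℂ} (hz : z ∉ spectrum ℂ X) :
    IsUnit (z • (1 : Matrix (Fin n) (Fin n) ℂ) - X).det := by
  rw [spectrum.notMem_iff, Algebra.algebraMap_eq_smul_one] at hz
  exact (Matrix.isUnit_iff_isUnit_det _).1 hz

theorem SurroundsSpectrum.isUnit_det (h : SurroundsSpectrum X r R θ) {z : ℂ}
    (hz : z ∈ sectorBoundary r R θ) : IsUnit (z • (1 : Matrix (Fin n) (Fin n) ℂ) - X).det := by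
  refine isUnit_det_of_notMem_spectrum fun hs => ?_
  obtain ⟨h1, h2, h3⟩ := h.2.2.2.2 z hs
  exact h.isSector.sub_ne_zero hz h1 h2 h3 (sub_self z)

theorem SurroundsSpectrum.continuousOn_resolvent (h : SurroundsSpectrum X r R θ)
    (i j : Fin n) :
    ContinuousOn (fun z => (z • (1 : Matrix (Fin n) (Fin n) ℂ) - X)⁻¹ i j)
      (sectorBoundary r R θ) := by
  have hc : Continuous fun z : ℂ => z • (1 : Matrix (Fin n) (Fin n) ℂ) - X := by fun_prop
  simp only [Matrix.inv_def, Ring.inverse_eq_inv', Matrix.smul_apply, smul_eq_mul]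
  exact (hc.matrix_det.continuousOn.inv₀ fun z hz => (h.isUnit_det hz).ne_zero).mul
    (hc.matrix_adjugate.matrix_elem i j).continuousOn

theorem SurroundsSpectrum.continuousOn_resolvent_mulVec (h : SurroundsSpectrum X r R θ)
    (v : Fin n → ℂ) (i : Fin n) :
    ContinuousOn (fun z => ((z • (1 : Matrix (Fin n) (Fin n) ℂ) - X)⁻¹.mulVec v) i)
      (sectorBoundary r R θ) := by
  simp only [Matrix.mulVec, dotProduct]
  exact continuousOn_finsetSum _ fun j _ => (h.continuousOn_resolvent i j).fun_mul continuousOn_const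

theorem cauchyIntegral_mulVec (h : SurroundsSpectrum X r R θ) {f : ℂ → ℂ}
    (hf : ContinuousOn f (sectorBoundary r R θ)) (v : Fin n → ℂ) (i : Fin n) :
    (cauchyIntegral f X r R θ).mulVec v i = (2 * Real.pi * I)⁻¹ *
      sectorIntegral r R θ fun z =>
        f z * ((z • (1 : Matrix (Fin n) (Fin n) ℂ) - X)⁻¹.mulVec v) i := by
  simp only [Matrix.mulVec, dotProduct, cauchyIntegral, Matrix.of_apply, Finset.mul_sum]
  rw [sectorIntegral_sum h.isSector, Finset.mul_sum]
  · refine Finset.sum_congr rfl fun j _ => ?_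
    rw [mul_assoc, mul_comm (sectorIntegral _ _ _ _), ← sectorIntegral_const_mul]
    congr 2
    ext z
    ring
  · exact fun j _ => hf.fun_mul ((h.continuousOn_resolvent i j).fun_mul continuousOn_const)

/-- Apply the resolvent to `X - a = (z - a) - (z - X)`. This trades a generalized eigenvector for
one of lower order at the price of a factor `(z - a)⁻¹`. -/
theorem resolvent_mulVec {z a : ℂ} (hz : IsUnit (z • (1 : Matrix (Fin n) (Fin n) ℂ) - X).det)
    (hza : z - a ≠ 0) (v : Fin n → ℂ) :
    (z • (1 : Matrix (Fin n) (Fin n) ℂ) - X)⁻¹.mulVec v = (z - a)⁻¹ • v +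
      (z - a)⁻¹ • (z • (1 : Matrix (Fin n) (Fin n) ℂ) - X)⁻¹.mulVec
        ((X - a • (1 : Matrix (Fin n) (Fin n) ℂ)).mulVec v) := by
  have e : X - a • (1 : Matrix (Fin n) (Fin n) ℂ)
      = (z - a) • (1 : Matrix (Fin n) (Fin n) ℂ) - (z • (1 : Matrix (Fin n) (Fin n) ℂ) - X) := by
    rw [sub_smul]; abel
  rw [e, Matrix.mulVec_mulVec, mul_sub, Matrix.nonsing_inv_mul _ hz, mul_smul_comm, mul_one,
    Matrix.sub_mulVec, Matrix.smul_mulVec, Matrix.one_mulVec, smul_sub, smul_smul,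
    inv_mul_cancel₀ hza, one_smul]
  abel

/-- Induction on the order of the generalized eigenvector. Since `resolvent_mulVec` raises the pole
order, the exponent `j` must stay general; powers of order at least two have primitives, so only the
simple pole at `j = 0` contributes. -/
theorem sectorIntegral_resolvent_of_pow_eq_zero (h : SurroundsSpectrum X r R θ) {a : ℂ}
    (ha : a ∈ spectrum ℂ X) (i : Fin n) (k : ℕ) (v : Fin n → ℂ)
    (hv : ((X - a • (1 : Matrix (Fin n) (Fin n) ℂ)) ^ k).mulVec v = 0) (j : ℕ) :
    sectorIntegral r R θ (fun z => ((z - a)⁻¹) ^ j *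
      ((z • (1 : Matrix (Fin n) (Fin n) ℂ) - X)⁻¹.mulVec v) i)
      = if j = 0 then 2 * Real.pi * I * v i else 0 := by
  obtain ⟨h1, h2, h3⟩ := h.2.2.2.2 a ha
  induction k generalizing v j with
  | zero =>
    have hv' : v = 0 := by simpa using hv
    simp [hv', sectorIntegral]
  | succ k ih =>
    set u := (X - a • (1 : Matrix (Fin n) (Fin n) ℂ)).mulVec v with hu
    have hu' : ((X - a • (1 : Matrix (Fin n) (Fin n) ℂ)) ^ k).mulVec u = 0 := by
      rw [hu, Matrix.mulVec_mulVec, ← pow_succ, hv]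
    have hI := continuousOn_inv_sub h.isSector h1 h2 h3
    rw [sectorIntegral_congr h.isSector (g := fun z => v i * ((z - a)⁻¹) ^ (j + 1)
      + ((z - a)⁻¹) ^ (j + 1) * ((z • (1 : Matrix (Fin n) (Fin n) ℂ) - X)⁻¹.mulVec u) i)]
    · rw [sectorIntegral_add h.isSector (continuousOn_const.fun_mul (hI.fun_pow _))
        ((hI.fun_pow _).fun_mul (h.continuousOn_resolvent_mulVec u i)), ih u hu' (j + 1),
        sectorIntegral_const_mul]
      rcases j with _ | j
      · simp only [zero_add, pow_one]
        rw [sectorIntegral_inv_sub h.isSector h1 h2 h3]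
        simp [mul_comm]
      · rw [sectorIntegral_inv_sub_pow h.isSector h1 h2 h3]
        simp
    · intro z hz
      simp only
      rw [resolvent_mulVec (h.isUnit_det hz) (h.isSector.sub_ne_zero hz h1 h2 h3) v, ← hu]
      simp only [Pi.add_apply, Pi.smul_apply, smul_eq_mul, pow_succ]
      ring

theorem two_pi_I_inv_mul : (2 * Real.pi * I)⁻¹ * (2 * Real.pi * I) = 1 :=
  inv_mul_cancel₀ two_pi_I_ne_zero

/-- The generalized eigenspaces span the space, so it is enough to test on generalized eigenvectors.
Those attached to a point outside the spectrum are zero. -/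
theorem cauchyIntegral_one (h : SurroundsSpectrum X r R θ) :
    cauchyIntegral (fun _ => 1) X r R θ = 1 := by
  have hmem : ∀ v : Fin n → ℂ, (cauchyIntegral (fun _ => 1) X r R θ).mulVec v = v := by
    intro v
    have hv : v ∈ ⨆ μ, Module.End.maxGenEigenspace (Matrix.toLin' X) μ := by
      rw [Module.End.iSup_maxGenEigenspace_eq_top]; trivial
    induction hv using Submodule.iSup_induction' with
    | mem a v hv =>
      obtain ⟨k, hk⟩ := (Module.End.mem_maxGenEigenspace _ _ _).1 hv
      have hk' : ((X - a • (1 : Matrix (Fin n) (Fin n) ℂ)) ^ k).mulVec v = 0 := by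
        rw [← hk, ← Matrix.toLin'_apply, Matrix.toLin'_pow, map_sub, map_smul, Matrix.toLin'_one]
        rfl
      by_cases ha : a ∈ spectrum ℂ X
      · ext i
        rw [cauchyIntegral_mulVec h continuousOn_const]
        have := sectorIntegral_resolvent_of_pow_eq_zero h ha i k v hk' 0
        simp only [pow_zero, if_true] at this
        rw [this, ← mul_assoc, two_pi_I_inv_mul, one_mul]
      · have hu := isUnit_det_of_notMem_spectrum ha
        have hu' : IsUnit ((X - a • (1 : Matrix (Fin n) (Fin n) ℂ)) ^ k) := by
          refine IsUnit.pow k ?_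
          rw [← IsUnit.neg_iff, neg_sub]
          exact (Matrix.isUnit_iff_isUnit_det _).2 hu
        have : v = 0 := by
          have := congrArg
            (((X - a • (1 : Matrix (Fin n) (Fin n) ℂ)) ^ k)⁻¹).mulVec hk'
          rwa [Matrix.mulVec_mulVec,
            Matrix.nonsing_inv_mul _ ((Matrix.isUnit_iff_isUnit_det _).1 hu'),
            Matrix.one_mulVec, Matrix.mulVec_zero] at this
        simp [this]
    | zero => simp
    | add v w _ _ hv hw => rw [Matrix.mulVec_add, hv, hw]
  refine Matrix.ext_of_mulVec_single fun i => ?_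
  rw [hmem, Matrix.one_mulVec]

theorem cauchyIntegral_congr (h : SurroundsSpectrum X r R θ) {f g : ℂ → ℂ}
    (hfg : EqOn f g slitPlane) : cauchyIntegral f X r R θ = cauchyIntegral g X r R θ := by
  ext i j
  simp only [cauchyIntegral, Matrix.of_apply]
  rw [sectorIntegral_congr h.isSector fun z hz => ?_]
  simp only [hfg (h.isSector.boundary_subset hz)]

theorem cauchyIntegral_add (h : SurroundsSpectrum X r R θ) {f g : ℂ → ℂ}
    (hf : DifferentiableOn ℂ f slitPlane) (hg : DifferentiableOn ℂ g slitPlane) :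
    cauchyIntegral (fun z => f z + g z) X r R θ
      = cauchyIntegral f X r R θ + cauchyIntegral g X r R θ := by
  ext i j
  simp only [cauchyIntegral, Matrix.of_apply, Matrix.add_apply, add_mul]
  rw [sectorIntegral_add h.isSector
    ((hf.continuousOn.mono h.isSector.boundary_subset).fun_mul (h.continuousOn_resolvent i j))
    ((hg.continuousOn.mono h.isSector.boundary_subset).fun_mul (h.continuousOn_resolvent i j)),
    mul_add]

theorem cauchyIntegral_const_mul (c : ℂ) (f : ℂ → ℂ) :
    cauchyIntegral (fun z => c * f z) X r R θ = c • cauchyIntegral f X r R θ := by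
  ext i j
  simp only [cauchyIntegral, Matrix.of_apply, Matrix.smul_apply, smul_eq_mul, mul_assoc c]
  rw [sectorIntegral_const_mul]
  ring

/-- From `z (z - X)⁻¹ = 1 + X (z - X)⁻¹`: the first summand contributes `∮ f = 0` by Cauchy's
theorem. -/
theorem cauchyIntegral_id_mul (h : SurroundsSpectrum X r R θ) {f : ℂ → ℂ}
    (hf : DifferentiableOn ℂ f slitPlane) :
    cauchyIntegral (fun z => z * f z) X r R θ = X * cauchyIntegral f X r R θ := by
  have hfc := hf.continuousOn.mono h.isSector.boundary_subset
  ext i j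
  rw [Matrix.mul_apply]
  simp only [cauchyIntegral, Matrix.of_apply]
  have e : EqOn (fun z => z * f z * (z • (1 : Matrix (Fin n) (Fin n) ℂ) - X)⁻¹ i j)
      (fun z => (1 : Matrix (Fin n) (Fin n) ℂ) i j * f z +
        ∑ k, X i k * (f z * (z • (1 : Matrix (Fin n) (Fin n) ℂ) - X)⁻¹ k j))
      (sectorBoundary r R θ) := by
    intro z hz
    have := Matrix.mul_nonsing_inv _ (h.isUnit_det hz)
    rw [sub_mul, smul_mul_assoc, one_mul, sub_eq_iff_eq_add] at this
    have := congrFun (congrFun this i) j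
    rw [Matrix.smul_apply, smul_eq_mul, Matrix.add_apply, Matrix.mul_apply] at this
    simp only
    rw [mul_right_comm, this, add_mul, Finset.sum_mul]
    congr 1
    exact Finset.sum_congr rfl fun k _ => by ring
  have hk : ∀ k, ContinuousOn (fun z => X i k *
      (f z * (z • (1 : Matrix (Fin n) (Fin n) ℂ) - X)⁻¹ k j)) (sectorBoundary r R θ) :=
    fun k => continuousOn_const.fun_mul (hfc.fun_mul (h.continuousOn_resolvent k j))
  rw [sectorIntegral_congr h.isSector e, sectorIntegral_add h.isSector
    (continuousOn_const.fun_mul hfc) (continuousOn_finsetSum _ fun k _ => hk k),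
    sectorIntegral_const_mul, sectorIntegral_eq_zero h.isSector hf,
    sectorIntegral_sum h.isSector _ fun k _ => hk k, mul_zero, zero_add, Finset.mul_sum]
  refine Finset.sum_congr rfl fun k _ => ?_
  rw [sectorIntegral_const_mul]
  ring

theorem cauchyIntegral_polynomial_mul (h : SurroundsSpectrum X r R θ)
    (q : Polynomial ℂ) {f : ℂ → ℂ} (hf : DifferentiableOn ℂ f slitPlane) :
    cauchyIntegral (fun z => q.eval z * f z) X r R θ
      = Polynomial.aeval X q * cauchyIntegral f X r R θ := by
  induction q using Polynomial.induction_on' with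
  | add p q hp hq =>
    simp only [Polynomial.eval_add, add_mul, map_add]
    rw [cauchyIntegral_add h (p.differentiable.differentiableOn.fun_mul hf)
      (q.differentiable.differentiableOn.fun_mul hf), hp, hq]
  | monomial k a =>
    have hp : ∀ k : ℕ, cauchyIntegral (fun z => z ^ k * f z) X r R θ
        = X ^ k * cauchyIntegral f X r R θ := by
      intro k
      induction k with
      | zero => simp
      | succ k ih =>
        have : (fun z : ℂ => z ^ (k + 1) * f z) = fun z => z * (z ^ k * f z) := by
          ext z; ring
        rw [this, cauchyIntegral_id_mul h ((differentiable_pow k).differentiableOn.fun_mul hf), ih,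
          pow_succ', mul_assoc]
    simp only [Polynomial.eval_monomial, mul_assoc]
    rw [cauchyIntegral_const_mul, hp, Polynomial.aeval_monomial, mul_assoc,
      Algebra.algebraMap_eq_smul_one, smul_one_mul]

/-- Hermite interpolation of a holomorphic function by a polynomial. -/
theorem exists_eq_polynomial_add_prod_mul (s : Multiset ℂ) (hs : ∀ a ∈ s, a ∈ slitPlane)
    {f : ℂ → ℂ} (hf : DifferentiableOn ℂ f slitPlane) :
    ∃ (q : Polynomial ℂ) (g : ℂ → ℂ), DifferentiableOn ℂ g slitPlane ∧
      ∀ z, f z = q.eval z + ((s.map fun a => Polynomial.X - Polynomial.C a).prod).eval z * g z := by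
  induction s using Multiset.induction_on generalizing f with
  | empty => exact ⟨0, f, hf, fun z => by simp⟩
  | cons a s ih =>
    have hd : DifferentiableOn ℂ (dslope f a) slitPlane :=
      (differentiableOn_dslope (isOpen_slitPlane.mem_nhds (hs a (by simp)))).2 hf
    obtain ⟨q, g, hg, hq⟩ := ih (fun b hb => hs b (by simp [hb])) hd
    refine ⟨Polynomial.C (f a) + (Polynomial.X - Polynomial.C a) * q, g, hg, fun z => ?_⟩
    have := sub_smul_dslope f a z
    rw [hq z, smul_eq_mul] at this
    simp only [Multiset.map_cons, Multiset.prod_cons, Polynomial.eval_add, Polynomial.eval_mul,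
      Polynomial.eval_C, Polynomial.eval_sub, Polynomial.eval_X]
    linear_combination -this

/-- Interpolating at the roots of the characteristic polynomial makes the remainder vanish at `X` by
Cayley–Hamilton. -/
theorem exists_eq_polynomial_add_charpoly_mul (hX : spectrum ℂ X ⊆ slitPlane)
    {f : ℂ → ℂ} (hf : DifferentiableOn ℂ f slitPlane) :
    ∃ (q : Polynomial ℂ) (g : ℂ → ℂ), DifferentiableOn ℂ g slitPlane ∧
      ∀ z, f z = q.eval z + X.charpoly.eval z * g z := by
  have hp : (X.charpoly.roots.map fun a => Polynomial.X - Polynomial.C a).prod = X.charpoly :=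
    ((IsAlgClosed.splits X.charpoly).eq_prod_roots_of_monic X.charpoly_monic).symm
  have := exists_eq_polynomial_add_prod_mul X.charpoly.roots (fun a ha => hX ?_) hf
  · rwa [hp] at this
  · exact Matrix.mem_spectrum_of_isRoot_charpoly (Polynomial.isRoot_of_mem_roots ha)

theorem SurroundsSpectrum.spectrum_subset (h : SurroundsSpectrum X r R θ) :
    spectrum ℂ X ⊆ slitPlane := by
  intro z hz
  obtain ⟨h1, h2, h3⟩ := h.2.2.2.2 z hz
  rw [mem_slitPlane_iff_arg]
  refine ⟨fun he => ?_, norm_pos_iff.1 (h.1.trans h1)⟩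
  have := h.2.2.2.1
  rw [he, abs_of_pos Real.pi_pos] at h3
  linarith

theorem cauchyIntegral_eq_aeval (h : SurroundsSpectrum X r R θ) {f g : ℂ → ℂ}
    {q : Polynomial ℂ} (hg : DifferentiableOn ℂ g slitPlane)
    (hf : ∀ z, f z = q.eval z + X.charpoly.eval z * g z) :
    cauchyIntegral f X r R θ = Polynomial.aeval X q := by
  have e : f = fun z => q.eval z * 1 + X.charpoly.eval z * g z := by
    ext z; rw [hf z, mul_one]
  rw [e, cauchyIntegral_add h (q.differentiable.differentiableOn.fun_mul (differentiableOn_const 1))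
    (X.charpoly.differentiable.differentiableOn.fun_mul hg),
    cauchyIntegral_polynomial_mul h q (differentiableOn_const 1),
    cauchyIntegral_polynomial_mul h _ hg, Matrix.aeval_self_charpoly, zero_mul, add_zero,
    cauchyIntegral_one h, mul_one]

theorem cauchyIntegral_mul (h : SurroundsSpectrum X r R θ) {f g : ℂ → ℂ}
    (hf : DifferentiableOn ℂ f slitPlane) (hg : DifferentiableOn ℂ g slitPlane) :
    cauchyIntegral (fun z => f z * g z) X r R θ
      = cauchyIntegral f X r R θ * cauchyIntegral g X r R θ := by
  obtain ⟨q, k, hk, hq⟩ := exists_eq_polynomial_add_charpoly_mul h.spectrum_subset hf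
  have e : (fun z => f z * g z) = fun z => q.eval z * g z + X.charpoly.eval z * (k z * g z) := by
    ext z; rw [hq z]; ring
  rw [cauchyIntegral_eq_aeval h hk hq, e, cauchyIntegral_add h
    (q.differentiable.differentiableOn.fun_mul hg)
    (X.charpoly.differentiable.differentiableOn.fun_mul (hk.fun_mul hg)),
    cauchyIntegral_polynomial_mul h q hg, cauchyIntegral_polynomial_mul h _ (hk.fun_mul hg),
    Matrix.aeval_self_charpoly, zero_mul, add_zero]

theorem exists_surroundsSpectrum (hX : spectrum ℂ X ⊆ slitPlane) :
    ∃ p : ℝ × ℝ × ℝ, SurroundsSpectrum X p.1 p.2.1 p.2.2 := by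
  have hfin := X.finite_spectrum
  have h1 : ∀ᶠ r : ℝ in nhdsWithin 0 (Ioi 0), ∀ z ∈ spectrum ℂ X, r < ‖z‖ :=
    (Filter.eventually_all_finite hfin).2 fun z hz => nhdsWithin_le_nhds
      (Iio_mem_nhds (norm_pos_iff.2 (slitPlane_ne_zero (hX hz))))
  have h2 : ∀ᶠ R : ℝ in Filter.atTop, ∀ z ∈ spectrum ℂ X, ‖z‖ < R :=
    (Filter.eventually_all_finite hfin).2 fun z hz => Filter.eventually_gt_atTop _
  have h3 : ∀ᶠ θ : ℝ in nhdsWithin Real.pi (Iio Real.pi), ∀ z ∈ spectrum ℂ X, |z.arg| < θ :=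
    (Filter.eventually_all_finite hfin).2 fun z hz => nhdsWithin_le_nhds
      (Ioi_mem_nhds (by
        have := (mem_slitPlane_iff_arg.1 (hX hz)).1
        exact abs_lt.2 ⟨neg_pi_lt_arg z, lt_of_le_of_ne (arg_le_pi z) this⟩))
  obtain ⟨r, hr, hr0⟩ := (h1.and self_mem_nhdsWithin).exists
  obtain ⟨R, hR, hR0⟩ := (h2.and (Filter.eventually_gt_atTop r)).exists
  obtain ⟨θ, ⟨hθ, hθ1⟩, hθ0⟩ := ((h3.and self_mem_nhdsWithin).and
    (nhdsWithin_le_nhds (Ioi_mem_nhds Real.pi_pos))).exists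
  exact ⟨(r, R, θ), hr0, hR0, hθ0, hθ1, fun z hz => ⟨hr z hz, hR z hz, hθ z hz⟩⟩

/-- One and the same contour computes `f(X)` for all `f`. -/
theorem exists_matFun_eq (hX : spectrum ℂ X ⊆ slitPlane) :
    ∃ r R θ : ℝ, SurroundsSpectrum X r R θ ∧
      ∀ f : ℂ → ℂ, matFun f X = cauchyIntegral f X r R θ := by
  have hex := exists_surroundsSpectrum hX
  exact ⟨_, _, _, hex.choose_spec, fun f => by rw [matFun, dif_pos hex]⟩

theorem matFun_mul (hX : spectrum ℂ X ⊆ slitPlane) {f g : ℂ → ℂ}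
    (hf : DifferentiableOn ℂ f slitPlane) (hg : DifferentiableOn ℂ g slitPlane) :
    matFun (fun z => f z * g z) X = matFun f X * matFun g X := by
  obtain ⟨r, R, θ, h, hm⟩ := exists_matFun_eq hX
  simp only [hm]
  exact cauchyIntegral_mul h hf hg

theorem matFun_congr (hX : spectrum ℂ X ⊆ slitPlane) {f g : ℂ → ℂ}
    (hfg : EqOn f g slitPlane) : matFun f X = matFun g X := by
  obtain ⟨r, R, θ, h, hm⟩ := exists_matFun_eq hX
  simp only [hm]
  exact cauchyIntegral_congr h hfg

theorem matFun_eval (hX : spectrum ℂ X ⊆ slitPlane) (q : Polynomial ℂ) :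
    matFun (fun z => q.eval z) X = Polynomial.aeval X q := by
  obtain ⟨r, R, θ, h, hm⟩ := exists_matFun_eq hX
  rw [hm]
  exact cauchyIntegral_eq_aeval h (g := fun _ => 0) (differentiableOn_const 0) (by simp)

/-! ### Similarity and the formula `A σ_f B = A f(A⁻¹B)` -/

theorem mul_aeval_eq_aeval_mul {S Y : Matrix (Fin n) (Fin n) ℂ} (hS : S * X = Y * S)
    (q : Polynomial ℂ) : S * Polynomial.aeval X q = Polynomial.aeval Y q * S := by
  induction q using Polynomial.induction_on' with
  | add p q hp hq => rw [map_add, map_add, mul_add, add_mul, hp, hq]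
  | monomial k a =>
    have : S * X ^ k = Y ^ k * S := (SemiconjBy.pow_right (show SemiconjBy S X Y from hS) k)
    rw [Polynomial.aeval_monomial, Polynomial.aeval_monomial, mul_assoc, ← this, ← mul_assoc,
      ← mul_assoc, Algebra.commutes]

theorem charpoly_eq_of_semiconj {S Y : Matrix (Fin n) (Fin n) ℂ} (hu : IsUnit S)
    (hS : S * X = Y * S) : Y.charpoly = X.charpoly := by
  obtain ⟨U, rfl⟩ := hu
  rw [← Matrix.charpoly_units_conj U X, hS, mul_assoc, Matrix.mul_nonsing_inv _
    ((Matrix.isUnit_iff_isUnit_det _).1 U.isUnit), mul_one]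

theorem spectrum_eq_of_semiconj {S Y : Matrix (Fin n) (Fin n) ℂ} (hu : IsUnit S)
    (hS : S * X = Y * S) : spectrum ℂ Y = spectrum ℂ X := by
  ext z
  rw [Matrix.mem_spectrum_iff_isRoot_charpoly, Matrix.mem_spectrum_iff_isRoot_charpoly,
    charpoly_eq_of_semiconj hu hS]

/-- The contours for `X` and `Y` are chosen separately, but similar matrices share their
characteristic polynomial, so one interpolating polynomial computes both values. -/
theorem mul_matFun_of_semiconj {S Y : Matrix (Fin n) (Fin n) ℂ} (hu : IsUnit S)
    (hS : S * X = Y * S) (hX : spectrum ℂ X ⊆ slitPlane) {f : ℂ → ℂ}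
    (hf : DifferentiableOn ℂ f slitPlane) : S * matFun f X = matFun f Y * S := by
  obtain ⟨q, g, hg, hq⟩ := exists_eq_polynomial_add_charpoly_mul hX hf
  obtain ⟨r, R, θ, h, hm⟩ := exists_matFun_eq hX
  obtain ⟨r', R', θ', h', hm'⟩ := exists_matFun_eq ((spectrum_eq_of_semiconj hu hS).trans_subset hX)
  rw [hm, hm', cauchyIntegral_eq_aeval h hg hq,
    cauchyIntegral_eq_aeval h' hg (by rwa [charpoly_eq_of_semiconj hu hS])]
  exact mul_aeval_eq_aeval_mul hS q

theorem differentiableOn_cpow_const (p : ℂ) :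
    DifferentiableOn ℂ (fun z : ℂ => z ^ p) slitPlane := fun z hz =>
  ((hasDerivAt_id z).cpow_const hz).differentiableAt.differentiableWithinAt

theorem matSqrt_mul_self (hX : spectrum ℂ X ⊆ slitPlane) : matSqrt X * matSqrt X = X := by
  unfold matSqrt
  rw [← matFun_mul hX (differentiableOn_cpow_const _) (differentiableOn_cpow_const _),
    matFun_congr hX (g := fun z => Polynomial.X.eval z), matFun_eval hX, Polynomial.aeval_X]
  intro z hz
  simp only [Polynomial.eval_X]
  rw [← cpow_add _ _ (slitPlane_ne_zero hz)]
  norm_num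

/-- With `S = A^(1/2)`, the matrix `S⁻¹ B S⁻¹` is the conjugate of `A⁻¹ B` by `S`, so `S` can be
moved across `f`. This removes square roots from everything that follows. -/
theorem mean_eq {A B : Matrix (Fin n) (Fin n) ℂ} (hA : IsUnit A)
    (hAs : spectrum ℂ A ⊆ slitPlane) (hX : spectrum ℂ (A⁻¹ * B) ⊆ slitPlane) {f : ℂ → ℂ}
    (hf : DifferentiableOn ℂ f slitPlane) : mean f A B = A * matFun f (A⁻¹ * B) := by
  unfold mean
  set S := matSqrt A
  have hSS : S * S = A := matSqrt_mul_self hAs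
  have hS : IsUnit S := isUnit_of_mul_isUnit_left (hSS ▸ hA)
  have hd := (Matrix.isUnit_iff_isUnit_det _).1 hS
  have hc : S * (A⁻¹ * B) = S⁻¹ * B * S⁻¹ * S := by
    rw [← hSS, Matrix.mul_inv_rev, mul_assoc (S⁻¹ * B), Matrix.nonsing_inv_mul _ hd, mul_one,
      ← mul_assoc, ← mul_assoc, Matrix.mul_nonsing_inv _ hd, one_mul]
  rw [mul_assoc, ← mul_matFun_of_semiconj hS hc hX hf, ← mul_assoc, hSS]

end

/-! ### Parameter integrals of holomorphic functions -/

section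

variable {ν : Measure ℝ} [IsFiniteMeasure ν]

theorem integrable_of_continuousOn_Icc (hν : ∀ᵐ s ∂ν, s ∈ Icc (0 : ℝ) 1) {E : Type*}
    [NormedAddCommGroup E] {f : ℝ → E} (hf : ContinuousOn f (Icc 0 1)) : Integrable f ν := by
  rw [← Measure.restrict_eq_self_of_ae_mem hν]
  exact hf.integrableOn_compact isCompact_Icc

theorem intervalIntegral_integral_swap_of_continuousOn (hν : ∀ᵐ s ∂ν, s ∈ Icc (0 : ℝ) 1)
    {a b : ℝ} (hab : a ≤ b) {F : ℝ → ℝ → ℂ}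
    (hF : ContinuousOn (Function.uncurry F) (Icc 0 1 ×ˢ Icc a b)) :
    Integrable (fun s => ∫ x in a..b, F s x) ν ∧
      ∫ x in a..b, ∫ s, F s x ∂ν = ∫ s, (∫ x in a..b, F s x) ∂ν := by
  have hint : Integrable (Function.uncurry F) (ν.prod (volume.restrict (Ioc a b))) := by
    rw [← Measure.restrict_eq_self_of_ae_mem hν, Measure.prod_restrict]
    exact (hF.integrableOn_compact (isCompact_Icc.prod isCompact_Icc)).mono_set
      (prod_mono le_rfl Ioc_subset_Icc_self)
  simp only [intervalIntegral.integral_of_le hab]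
  exact ⟨hint.integral_prod_left, (integral_integral_swap hint).symm⟩

variable {K : ℝ → ℂ → ℂ}

theorem continuousOn_slice (hK : ContinuousOn (Function.uncurry K) (Icc 0 1 ×ˢ slitPlane)) {z : ℂ}
    (hz : z ∈ slitPlane) : ContinuousOn (fun s => K s z) (Icc 0 1) :=
  hK.comp (f := fun s : ℝ => (s, z)) (by fun_prop) fun _ hs => ⟨hs, hz⟩

theorem hasDerivAt_integral_slitPlane (hν : ∀ᵐ s ∂ν, s ∈ Icc (0 : ℝ) 1) {K' : ℝ → ℂ → ℂ}
    (hK : ContinuousOn (Function.uncurry K) (Icc 0 1 ×ˢ slitPlane))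
    (hK' : ContinuousOn (Function.uncurry K') (Icc 0 1 ×ˢ slitPlane))
    (hd : ∀ s ∈ Icc (0 : ℝ) 1, ∀ z ∈ slitPlane, HasDerivAt (K s) (K' s z) z)
    {z : ℂ} (hz : z ∈ slitPlane) :
    HasDerivAt (fun z => ∫ s, K s z ∂ν) (∫ s, K' s z ∂ν) z := by
  -- On the compact set `[0, 1] × closedBall z ε` the derivative `K'` is bounded, which supplies the
  -- dominating constant.
  obtain ⟨ε, hε, hball⟩ := Metric.nhds_basis_closedBall.mem_iff.1 (isOpen_slitPlane.mem_nhds hz)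
  obtain ⟨C, hC⟩ := (isCompact_Icc.prod (isCompact_closedBall z ε)).exists_bound_of_continuousOn
    (hK'.mono (prod_mono le_rfl hball))
  refine (hasDerivAt_integral_of_dominated_loc_of_deriv_le (F := fun z s => K s z)
    (F' := fun z s => K' s z) (bound := fun _ => C) (Metric.closedBall_mem_nhds z hε)
    ?_ (integrable_of_continuousOn_Icc hν (continuousOn_slice hK hz))
    (integrable_of_continuousOn_Icc hν (continuousOn_slice hK' hz)).aestronglyMeasurable
    ?_ (integrable_const _) ?_).2
  · filter_upwards [isOpen_slitPlane.mem_nhds hz] with w hw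
    exact (integrable_of_continuousOn_Icc hν (continuousOn_slice hK hw)).aestronglyMeasurable
  · filter_upwards [hν] with s hs w hw
    exact hC (s, w) ⟨hs, hw⟩
  · filter_upwards [hν] with s hs w hw
    exact hd s hs w (hball hw)

theorem sectorIntegral_integral {r R θ : ℝ} (h : IsSector r R θ)
    (hν : ∀ᵐ s ∂ν, s ∈ Icc (0 : ℝ) 1)
    (hK : ContinuousOn (Function.uncurry K) (Icc 0 1 ×ˢ slitPlane)) {g : ℂ → ℂ}
    (hg : ContinuousOn g (sectorBoundary r R θ)) :
    Integrable (fun s => sectorIntegral r R θ fun z => K s z * g z) ν ∧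
      (sectorIntegral r R θ fun z => (∫ s, K s z ∂ν) * g z)
        = ∫ s, (sectorIntegral r R θ fun z => K s z * g z) ∂ν := by
  have hθ : -θ ≤ θ := by linarith [h.angle_pos]
  have piece : ∀ (a b : ℝ) (γ w : ℝ → ℂ), a ≤ b → Continuous γ → Continuous w →
      (∀ x ∈ Icc a b, γ x ∈ sectorBoundary r R θ) →
      Integrable (fun s => ∫ x in a..b, K s (γ x) * g (γ x) * w x) ν ∧
        ∫ x in a..b, (∫ s, K s (γ x) ∂ν) * g (γ x) * w x
          = ∫ s, (∫ x in a..b, K s (γ x) * g (γ x) * w x) ∂ν := by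
    intro a b γ w hab hγ hw hm
    simp only [← integral_mul_const]
    refine intervalIntegral_integral_swap_of_continuousOn hν hab ?_
    refine ContinuousOn.mul (ContinuousOn.mul ?_ ?_) (by fun_prop)
    · exact hK.comp (f := fun q : ℝ × ℝ => (q.1, γ q.2)) (by fun_prop)
        fun q hq => ⟨hq.1, h.boundary_subset (hm _ hq.2)⟩
    · exact hg.comp (f := fun q : ℝ × ℝ => γ q.2) (by fun_prop) fun q hq => hm _ hq.2
  obtain ⟨i1, e1⟩ := piece _ _ (fun φ => R * exp (φ * I)) (fun φ => I * R * exp (φ * I)) hθ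
    (by fun_prop) (by fun_prop) fun φ hφ => h.outer_mem hφ
  obtain ⟨i2, e2⟩ := piece _ _ (fun ρ => ρ * exp (θ * I)) (fun ρ => exp (θ * I)) h.lt.le
    (by fun_prop) (by fun_prop) fun φ hφ => h.upper_mem hφ
  obtain ⟨i3, e3⟩ := piece _ _ (fun φ => r * exp (φ * I)) (fun φ => I * r * exp (φ * I)) hθ
    (by fun_prop) (by fun_prop) fun φ hφ => h.inner_mem hφ
  obtain ⟨i4, e4⟩ := piece _ _ (fun ρ => ρ * exp (-θ * I)) (fun ρ => exp (-θ * I)) h.lt.le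
    (by fun_prop) (by fun_prop) fun φ hφ => h.lower_mem hφ
  unfold sectorIntegral
  have i5 := i1.sub' i2
  have i6 := i5.sub' i3
  refine ⟨i6.fun_add i4, ?_⟩
  rw [e1, e2, e3, e4, integral_add i6 i4, integral_sub i5 i3, integral_sub i1 i2]

theorem matFun_integral {n : ℕ} {X : Matrix (Fin n) (Fin n) ℂ}
    (hX : spectrum ℂ X ⊆ slitPlane) (hν : ∀ᵐ s ∂ν, s ∈ Icc (0 : ℝ) 1)
    (hK : ContinuousOn (Function.uncurry K) (Icc 0 1 ×ˢ slitPlane)) (i j : Fin n) :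
    Integrable (fun s => matFun (K s) X i j) ν ∧
      matFun (fun z => ∫ s, K s z ∂ν) X i j = ∫ s, matFun (K s) X i j ∂ν := by
  obtain ⟨r, R, θ, h, hm⟩ := exists_matFun_eq hX
  obtain ⟨h1, h2⟩ := sectorIntegral_integral h.isSector hν hK (h.continuousOn_resolvent i j)
  simp only [hm, cauchyIntegral, Matrix.of_apply]
  exact ⟨h1.const_mul _, by rw [h2, integral_const_mul]⟩

/-- The pairs of matrices for which the means are defined by the functional calculus of
`A⁻¹ * B`. -/
structure IsRegularPair {n : ℕ} (A B : Matrix (Fin n) (Fin n) ℂ) : Prop where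
  isUnit : IsUnit A
  spectrum_left : spectrum ℂ A ⊆ slitPlane
  spectrum_quot : spectrum ℂ (A⁻¹ * B) ⊆ slitPlane

/-- Fubini on the contour, entry by entry. The kernel derivative `K'` is there to make `f`
holomorphic by differentiation under the integral, as `mean_eq` requires. -/
theorem mean_integral {n : ℕ} {A B : Matrix (Fin n) (Fin n) ℂ} (hAB : IsRegularPair A B)
    (hν : ∀ᵐ s ∂ν, s ∈ Icc (0 : ℝ) 1) {K' : ℝ → ℂ → ℂ}
    (hK : ContinuousOn (Function.uncurry K) (Icc 0 1 ×ˢ slitPlane))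
    (hK' : ContinuousOn (Function.uncurry K') (Icc 0 1 ×ˢ slitPlane))
    (hd : ∀ s ∈ Icc (0 : ℝ) 1, ∀ z ∈ slitPlane, HasDerivAt (K s) (K' s z) z)
    {f : ℂ → ℂ} (hf : ∀ z ∈ slitPlane, f z = ∫ s, K s z ∂ν) (i j : Fin n) :
    Integrable (fun s => mean (K s) A B i j) ν ∧
      mean f A B i j = ∫ s, mean (K s) A B i j ∂ν := by
  have hdf : DifferentiableOn ℂ f slitPlane := by
    refine DifferentiableOn.congr (fun z hz => ?_) hf
    exact (hasDerivAt_integral_slitPlane hν hK hK' hd hz).differentiableAt.differentiableWithinAt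
  have hm : ∀ᵐ s ∂ν, ∑ k, A i k * matFun (K s) (A⁻¹ * B) k j = mean (K s) A B i j := by
    filter_upwards [hν] with s hs
    rw [mean_eq hAB.isUnit hAB.spectrum_left hAB.spectrum_quot fun z hz =>
      (hd s hs z hz).differentiableAt.differentiableWithinAt, Matrix.mul_apply]
  have hint := fun k => matFun_integral hAB.spectrum_quot hν hK k j
  refine ⟨(integrable_finsetSum _ fun k _ => (hint k).1.const_mul (A i k)).congr hm, ?_⟩
  rw [← integral_congr_ae hm, mean_eq hAB.isUnit hAB.spectrum_left hAB.spectrum_quot hdf,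
    Matrix.mul_apply, integral_finsetSum _ fun k _ => (hint k).1.const_mul (A i k),
    matFun_congr hAB.spectrum_quot hf]
  refine Finset.sum_congr rfl fun k _ => ?_
  rw [(hint k).2, integral_const_mul]

end

/-! ### The power functions as mixtures of harmonic means -/

/-- The denominator lies on the segment from `1` to `z`, and the cut plane is star-shaped about `1`.
-/
theorem harm_den_mem_slitPlane {s : ℝ} (hs : s ∈ Icc (0 : ℝ) 1) {z : ℂ} (hz : z ∈ slitPlane) :
    (1 - s) * z + s ∈ slitPlane := by
  have := starConvex_one_slitPlane hz (a := s) (b := 1 - s) hs.1 (by linarith [hs.2]) (by ring)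
  simpa [add_comm] using this

theorem hasDerivAt_harm {s : ℝ} (hs : s ∈ Icc (0 : ℝ) 1) {z : ℂ} (hz : z ∈ slitPlane) :
    HasDerivAt (fun z : ℂ => z / ((1 - s) * z + s)) (s / ((1 - s) * z + s) ^ 2) z := by
  have h0 := slitPlane_ne_zero (harm_den_mem_slitPlane hs hz)
  have := (hasDerivAt_id' z).fun_div (((hasDerivAt_id' z).const_mul (1 - s : ℂ)).add_const (s : ℂ)) h0
  refine this.congr_deriv ?_
  congr 1
  ring

theorem continuousOn_harm :
    ContinuousOn (Function.uncurry fun (s : ℝ) (z : ℂ) => z / ((1 - s) * z + s))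
      (Icc 0 1 ×ˢ slitPlane) := by
  refine ContinuousOn.div (f := fun q : ℝ × ℂ => q.2)
    (g := fun q : ℝ × ℂ => (1 - q.1) * q.2 + q.1) (by fun_prop) (by fun_prop) ?_
  exact fun q hq => slitPlane_ne_zero (harm_den_mem_slitPlane hq.1 hq.2)

theorem continuousOn_harm_deriv :
    ContinuousOn (Function.uncurry fun (s : ℝ) (z : ℂ) => s / ((1 - s) * z + s) ^ 2)
      (Icc 0 1 ×ˢ slitPlane) := by
  refine ContinuousOn.div (f := fun q : ℝ × ℂ => (q.1 : ℂ))
    (g := fun q : ℝ × ℂ => ((1 - q.1) * q.2 + q.1) ^ 2) (by fun_prop) (by fun_prop) ?_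
  exact fun q hq => pow_ne_zero 2 (slitPlane_ne_zero (harm_den_mem_slitPlane hq.1 hq.2))

/-- The substitution `s = t / (1 + t)` carries the integrand over `(0, ∞)` to a harmonic kernel with
weight `s`, leaving a density that does not depend on `x`. -/
theorem rpowIntegrand_eq_mul {p t x : ℝ} (ht : 0 < t) (hx : 0 < x) :
    Real.rpowIntegrand₀₁ p t x
      = Real.rpowIntegrand₀₁ p t 1 * (x / ((1 - t / (1 + t)) * x + t / (1 + t))) := by
  have h1 : 1 + t ≠ 0 := by positivity
  have h2 : t + x ≠ 0 := by positivity
  have h3 : (1 - t / (1 + t)) * x + t / (1 + t) = (t + x) / (1 + t) := by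
    field_simp; ring
  rw [h3]
  unfold Real.rpowIntegrand₀₁
  rw [add_comm t 1]
  field_simp
  ring

theorem exists_measure_rpow {p : ℝ} (hp : p ∈ Ioo (0 : ℝ) 1) :
    ∃ ν : Measure ℝ, IsProbabilityMeasure ν ∧ (∀ᵐ s ∂ν, s ∈ Icc (0 : ℝ) 1) ∧
      ∀ x : ℝ, 0 < x → x ^ p = ∫ s, x / ((1 - s) * x + s) ∂ν := by
  -- The normalizing constant in the integral representation of `x ^ p`. The measure sought is the
  -- image of the density `c * rpowIntegrand₀₁ p t 1` under `t ↦ t / (1 + t)`.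
  set c := (∫ t in Ioi (0 : ℝ), Real.rpowIntegrand₀₁ p t 1)⁻¹ with hc
  have hn : ∀ t ∈ Ioi (0 : ℝ), 0 ≤ Real.rpowIntegrand₀₁ p t 1 := fun t ht =>
    Real.rpowIntegrand₀₁_nonneg hp.1 (le_of_lt ht) zero_le_one
  have hc0 : 0 ≤ c := inv_nonneg.2 (setIntegral_nonneg measurableSet_Ioi hn)
  have hint := Real.integrableOn_rpowIntegrand₀₁_Ioi hp zero_le_one
  set d : ℝ → ENNReal := fun t => ENNReal.ofReal (c * Real.rpowIntegrand₀₁ p t 1) with hd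
  have hdm : Measurable d := by
    unfold d Real.rpowIntegrand₀₁
    fun_prop
  set ν₀ := (volume.restrict (Ioi (0 : ℝ))).withDensity d with hν₀
  have hφm : Measurable fun t : ℝ => t / (1 + t) := by fun_prop
  have hpos : ∀ᵐ t ∂ν₀, t ∈ Ioi (0 : ℝ) :=
    (withDensity_absolutelyContinuous _ _).ae_le (ae_restrict_mem measurableSet_Ioi)
  have hval : ∀ x : ℝ, 0 < x →
      ∫ s, x / ((1 - s) * x + s) ∂(ν₀.map fun t => t / (1 + t)) = x ^ p := by
    intro x hx
    rw [integral_map hφm.aemeasurable (Measurable.aestronglyMeasurable (by fun_prop)), hν₀,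
      integral_withDensity_eq_integral_toReal_smul hdm (by simp [hd]),
      Real.rpow_eq_const_mul_integral hp hx.le, ← integral_const_mul]
    refine setIntegral_congr_fun measurableSet_Ioi fun t ht => ?_
    simp only [hd, smul_eq_mul]
    rw [ENNReal.toReal_ofReal (mul_nonneg hc0 (hn t ht)), rpowIntegrand_eq_mul ht hx]
    ring
  have : IsFiniteMeasure ν₀ := isFiniteMeasure_withDensity_ofReal
    (hint.const_mul c).2
  refine ⟨ν₀.map fun t => t / (1 + t), ?_, ?_, fun x hx => (hval x hx).symm⟩
  -- At `x = 1` the kernel is constantly 1, so the representation reads off the total mass.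
  · have := hval 1 one_pos
    simp only [mul_one, sub_add_cancel, div_one, Real.one_rpow, integral_const, smul_eq_mul] at this
    refine ⟨?_⟩
    rw [← ENNReal.toReal_eq_one_iff]
    exact this
  · refine (ae_map_iff hφm.aemeasurable (p := (· ∈ Icc (0 : ℝ) 1)) measurableSet_Icc).2 ?_
    filter_upwards [hpos] with t ht
    have ht' : 0 < t := ht
    exact ⟨by positivity, (div_le_one (by positivity)).2 (by linarith)⟩

/-- The principal power `z ^ p` with `0 < p < 1` is an average of the functions
`z / ((1 - s) z + s)` over a probability distribution of `s ∈ [0, 1]` with mean `p`. -/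
theorem exists_measure_cpow {p : ℝ} (hp : p ∈ Ioo (0 : ℝ) 1) :
    ∃ ν : Measure ℝ, IsProbabilityMeasure ν ∧ (∀ᵐ s ∂ν, s ∈ Icc (0 : ℝ) 1) ∧
      ∫ s, s ∂ν = p ∧
      ∀ z ∈ slitPlane, z ^ (p : ℂ) = ∫ s : ℝ, z / ((1 - s) * z + s) ∂ν := by
  obtain ⟨ν, hpr, hν, hx⟩ := exists_measure_rpow hp
  have hder : ∀ z ∈ slitPlane, _ := fun z hz =>
    hasDerivAt_integral_slitPlane hν continuousOn_harm continuousOn_harm_deriv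
      (fun s hs z hz => hasDerivAt_harm hs hz) (z := z) hz
  have hreal : ∀ x : ℝ, 0 < x →
      (x : ℂ) ^ (p : ℂ) = ∫ s : ℝ, (x : ℂ) / ((1 - s) * x + s) ∂ν := by
    intro x h0
    rw [← ofReal_cpow h0.le, hx x h0, ← integral_complex_ofReal]
    push_cast
    rfl
  have heq : EqOn (fun z : ℂ => z ^ (p : ℂ)) (fun z => ∫ s : ℝ, z / ((1 - s) * z + s) ∂ν)
      slitPlane := by
    -- Identity theorem: both sides are analytic on the cut plane and agree on the positive reals,
    -- which accumulate at `1`.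
    refine AnalyticOnNhd.eqOn_of_preconnected_of_frequently_eq
      ((differentiableOn_cpow_const p).analyticOnNhd isOpen_slitPlane)
      (DifferentiableOn.analyticOnNhd (fun z hz =>
        (hder z hz).differentiableAt.differentiableWithinAt) isOpen_slitPlane)
      ((starConvex_one_slitPlane.isPathConnected (by simp)).isConnected.isPreconnected)
      (z₀ := 1) (by simp) ?_
    have ht : Filter.Tendsto (fun x : ℝ => (x : ℂ)) (nhdsWithin 1 {1}ᶜ) (nhdsWithin 1 {1}ᶜ) := by
      refine tendsto_nhdsWithin_iff.2 ⟨?_, ?_⟩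
      · simpa using (continuous_ofReal.tendsto (1 : ℝ)).mono_left nhdsWithin_le_nhds
      · filter_upwards [self_mem_nhdsWithin] with x hx
        simpa using hx
    refine ht.frequently (Filter.Eventually.frequently ?_)
    filter_upwards [nhdsWithin_le_nhds (Ioi_mem_nhds (zero_lt_one' ℝ))] with x h0
    exact hreal x h0
  refine ⟨ν, hpr, hν, ?_, fun z hz => heq hz⟩
  -- Comparing derivatives at `z = 1`, where the kernel has derivative `s` and the power has
  -- derivative `p`, gives the mean of `ν`.
  have h1 := (hder 1 (by simp)).congr_of_eventuallyEq
    (Filter.eventuallyEq_of_mem (isOpen_slitPlane.mem_nhds (by simp)) heq)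
  have h2 := (hasDerivAt_id (1 : ℂ)).cpow_const (c := (p : ℂ)) (by simp)
  have h3 := h1.unique h2
  simp only [mul_one, sub_add_cancel, one_pow, div_one, id_eq, one_cpow] at h3
  rw [integral_complex_ofReal] at h3
  exact_mod_cast h3

/-! ### The weighted logarithmic mean as a mixture of powers -/

/-- The probability distribution of the exponents that represents the weighted logarithmic
mean. -/
def expMeasure (t : ℝ) : Measure ℝ :=
  ENNReal.ofReal ((1 - t) / t) • volume.restrict (Ioo 0 t)
    + ENNReal.ofReal (t / (1 - t)) • volume.restrict (Ioo t 1)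

section

variable {t : ℝ} (ht₀ : 0 < t) (ht₁ : t < 1)

instance : IsFiniteMeasure (expMeasure t) := by
  have h1 := (volume.restrict (Ioo 0 t)).smul_finite (ENNReal.ofReal_ne_top (r := (1 - t) / t))
  have h2 := (volume.restrict (Ioo t 1)).smul_finite (ENNReal.ofReal_ne_top (r := t / (1 - t)))
  unfold expMeasure
  infer_instance

include ht₀ ht₁

/-- The endpoints are left out because the mixture of harmonic means is constructed only for `0 < p
< 1`. -/
theorem ae_expMeasure : ∀ᵐ p ∂(expMeasure t), p ∈ Ioo (0 : ℝ) 1 := by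
  unfold expMeasure
  rw [ae_add_measure_iff]
  constructor <;> refine (Measure.smul_absolutelyContinuous).ae_le ?_
  · filter_upwards [ae_restrict_mem measurableSet_Ioo] with p hp
    exact ⟨hp.1, hp.2.trans ht₁⟩
  · filter_upwards [ae_restrict_mem measurableSet_Ioo] with p hp
    exact ⟨ht₀.trans hp.1, hp.2⟩

theorem ae_expMeasure_Icc : ∀ᵐ p ∂(expMeasure t), p ∈ Icc (0 : ℝ) 1 := by
  filter_upwards [ae_expMeasure ht₀ ht₁] with p hp
  exact Ioo_subset_Icc_self hp

theorem integral_expMeasure {E : Type*} [NormedAddCommGroup E] [NormedSpace ℝ E] {f : ℝ → E}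
    (hf : Integrable f (expMeasure t)) :
    ∫ p, f p ∂(expMeasure t) =
      ((1 - t) / t) • (∫ p in (0 : ℝ)..t, f p) + (t / (1 - t)) • ∫ p in t..1, f p := by
  have h1 : 0 ≤ (1 - t) / t := div_nonneg (by linarith) ht₀.le
  have h2 : 0 ≤ t / (1 - t) := div_nonneg ht₀.le (by linarith)
  unfold expMeasure at hf ⊢
  rw [integral_add_measure hf.left_of_add_measure hf.right_of_add_measure,
    integral_smul_measure, integral_smul_measure, ENNReal.toReal_ofReal h1,
    ENNReal.toReal_ofReal h2, intervalIntegral.integral_of_le ht₀.le,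
    intervalIntegral.integral_of_le ht₁.le, integral_Ioc_eq_integral_Ioo,
    integral_Ioc_eq_integral_Ioo]

theorem integral_expMeasure_of_continuousOn {E : Type*} [NormedAddCommGroup E] [NormedSpace ℝ E]
    {f : ℝ → E} (hf : ContinuousOn f (Icc 0 1)) :
    ∫ p, f p ∂(expMeasure t) =
      ((1 - t) / t) • (∫ p in (0 : ℝ)..t, f p) + (t / (1 - t)) • ∫ p in t..1, f p :=
  integral_expMeasure ht₀ ht₁ (integrable_of_continuousOn_Icc (ae_expMeasure_Icc ht₀ ht₁) hf)

theorem isProbabilityMeasure_expMeasure : IsProbabilityMeasure (expMeasure t) := by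
  have := integral_expMeasure_of_continuousOn ht₀ ht₁ (f := fun _ => (1 : ℝ)) continuousOn_const
  have h1 : 1 - t ≠ 0 := by linarith
  refine ⟨?_⟩
  rw [← ENNReal.toReal_eq_one_iff]
  simp only [integral_const, smul_eq_mul, mul_one, intervalIntegral.integral_const, sub_zero] at this
  rw [Measure.real] at this
  rw [this]
  field_simp
  ring

theorem integral_id_expMeasure : ∫ p, p ∂(expMeasure t) = t := by
  have h1 : 1 - t ≠ 0 := by linarith
  rw [integral_expMeasure_of_continuousOn ht₀ ht₁ (f := fun p => p) continuousOn_id]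
  simp only [smul_eq_mul, integral_id]
  field_simp
  ring

omit ht₀ ht₁ in
theorem continuousOn_cpow :
    ContinuousOn (Function.uncurry fun (p : ℝ) (z : ℂ) => z ^ (p : ℂ)) (Icc 0 1 ×ˢ slitPlane) :=
  ContinuousOn.cpow (f := fun q : ℝ × ℂ => q.2) (g := fun q : ℝ × ℂ => (q.1 : ℂ)) (by fun_prop)
    (by fun_prop) fun q hq => hq.2

omit ht₀ ht₁ in
theorem continuousOn_cpow_deriv :
    ContinuousOn (Function.uncurry fun (p : ℝ) (z : ℂ) => (p : ℂ) * z ^ ((p : ℂ) - 1))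
      (Icc 0 1 ×ˢ slitPlane) :=
  ContinuousOn.mul (f := fun q : ℝ × ℂ => (q.1 : ℂ)) (by fun_prop)
    (ContinuousOn.cpow (f := fun q : ℝ × ℂ => q.2) (g := fun q : ℝ × ℂ => (q.1 : ℂ) - 1)
      (by fun_prop) (by fun_prop) fun q hq => hq.2)

omit ht₀ ht₁ in
theorem hasDerivAt_cpow (p : ℝ) {z : ℂ} (hz : z ∈ slitPlane) :
    HasDerivAt (fun z : ℂ => z ^ (p : ℂ)) ((p : ℂ) * z ^ ((p : ℂ) - 1)) z := by
  simpa using (hasDerivAt_id z).cpow_const (c := (p : ℂ)) hz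

omit ht₀ ht₁ in
theorem integral_cpow_exponent {z : ℂ} (hz : z ∈ slitPlane) (h1 : z ≠ 1) (a b : ℝ) :
    ∫ p : ℝ in a..b, z ^ (p : ℂ) = (z ^ (b : ℂ) - z ^ (a : ℂ)) / log z := by
  have h0 := slitPlane_ne_zero hz
  have hl : log z ≠ 0 := fun h => h1 (by rw [← exp_log h0, h, exp_zero])
  simp only [cpow_def_of_ne_zero h0]
  exact integral_exp_mul_complex hl

theorem logFunC_eq_integral {z : ℂ} (hz : z ∈ slitPlane) :
    logFunC t z = ∫ p : ℝ, z ^ (p : ℂ) ∂(expMeasure t) := by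
  unfold logFunC
  split_ifs with h
  -- The special value `1` at `z = 1` is the total mass.
  · have := isProbabilityMeasure_expMeasure ht₀ ht₁
    simp [h]
  · rw [integral_expMeasure_of_continuousOn ht₀ ht₁ (continuousOn_slice continuousOn_cpow hz),
      integral_cpow_exponent hz h, integral_cpow_exponent hz h]
    simp

theorem logFun_eq_integral {x : ℝ} (hx : 0 < x) :
    logFun t x = ∫ p : ℝ, x ^ p ∂(expMeasure t) := by
  have := logFunC_eq_integral ht₀ ht₁ (z := x) (Or.inl (by simpa using hx))
  rw [logFunC_ofReal t hx] at this
  simp only [← ofReal_cpow hx.le] at this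
  rw [integral_complex_ofReal] at this
  exact_mod_cast this

theorem hasDerivAt_logFunC {z : ℂ} (hz : z ∈ slitPlane) :
    HasDerivAt (logFunC t) (∫ p : ℝ, (p : ℂ) * z ^ ((p : ℂ) - 1) ∂(expMeasure t)) z :=
  (hasDerivAt_integral_slitPlane (ae_expMeasure_Icc ht₀ ht₁) continuousOn_cpow
    continuousOn_cpow_deriv (fun p _ _ hw => hasDerivAt_cpow p hw) hz).congr_of_eventuallyEq
    (Filter.eventuallyEq_of_mem (isOpen_slitPlane.mem_nhds hz)
      fun _ hw => logFunC_eq_integral ht₀ ht₁ hw)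

/-- At `1` the power `z ^ p` has derivative `p`, so the derivative is the mean of `expMeasure t`. -/
theorem hasDerivAt_logFun_one : HasDerivAt (logFun t) t 1 := by
  have h := hasDerivAt_logFunC ht₀ ht₁ (z := (1 : ℝ)) (by simp)
  simp only [ofReal_one, one_cpow, mul_one] at h
  rw [integral_complex_ofReal, integral_id_expMeasure ht₀ ht₁, ← ofReal_one] at h
  refine (h.real_of_complex).congr_of_eventuallyEq ?_
  filter_upwards [Ioi_mem_nhds (zero_lt_one' ℝ)] with x hx
  rw [logFunC_ofReal t hx, ofReal_re]

theorem logFun_pos {x : ℝ} (hx : 0 < x) : 0 < logFun t x := by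
  have := isProbabilityMeasure_expMeasure ht₀ ht₁
  rw [logFun_eq_integral ht₀ ht₁ hx]
  have hi : Integrable (fun p : ℝ => x ^ p) (expMeasure t) :=
    integrable_of_continuousOn_Icc (ae_expMeasure_Icc ht₀ ht₁)
      (Real.continuous_const_rpow hx.ne').continuousOn
  rw [integral_pos_iff_support_of_nonneg (fun p => (Real.rpow_pos_of_pos hx p).le) hi]
  have : Function.support (fun p : ℝ => x ^ p) = univ :=
    eq_univ_of_forall fun p => (Real.rpow_pos_of_pos hx p).ne'
  rw [this]
  simp

end

/-! ### Quadratic forms of sectorial matrices -/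

section

variable {n : ℕ}

/-- The sesquilinear form `⟨K u, y⟩`. -/
def form (K : Matrix (Fin n) (Fin n) ℂ) (u y : Fin n → ℂ) : ℂ := star y ⬝ᵥ K.mulVec u

variable (K L : Matrix (Fin n) (Fin n) ℂ) (u v y w : Fin n → ℂ) (c : ℂ)

theorem form_add_left : form K (u + v) y = form K u y + form K v y := by
  simp [form, Matrix.mulVec_add]

theorem form_add_right : form K u (y + w) = form K u y + form K u w := by
  simp [form]

theorem form_smul_left : form K (c • u) y = c * form K u y := by
  simp [form, Matrix.mulVec_smul]

theorem form_smul_right : form K u (c • y) = star c * form K u y := by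
  simp [form]

theorem form_add : form (K + L) u y = form K u y + form L u y := by
  simp [form, Matrix.add_mulVec]

theorem form_sub : form (K - L) u y = form K u y - form L u y := by
  simp [form, Matrix.sub_mulVec]

theorem form_real_smul (a : ℝ) : form (a • K) u y = a * form K u y := by
  simp [form, Matrix.smul_mulVec]

theorem form_re_real_smul (a : ℝ) : (form (a • K) u y).re = a * (form K u y).re := by
  rw [form_real_smul, re_ofReal_mul]

/-- The values `⟨K x, x⟩` lie in the sector `|Im z| ≤ τ Re z`, and in the open right half plane
for `x ≠ 0`. -/
structure IsSectorialForm (τ : ℝ) (K : Matrix (Fin n) (Fin n) ℂ) : Prop where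
  re_pos : ∀ x, x ≠ 0 → 0 < (form K x x).re
  abs_im_le : ∀ x, |(form K x x).im| ≤ τ * (form K x x).re

theorem IsSectorial.isSectorialForm {α : ℝ} {A : Matrix (Fin n) (Fin n) ℂ}
    (hA : IsSectorial α A) : IsSectorialForm (Real.tan α) A := by
  have key : ∀ x : Fin n → ℂ, x ≠ 0 → 0 < (form A x x).re ∧
      |(form A x x).im| ≤ Real.tan α * (form A x x).re := by
    intro x hx
    set e : EuclideanSpace ℂ (Fin n) := WithLp.toLp 2 x with he
    have he0 : e ≠ 0 := fun h => hx (by simpa [he] using h)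
    have hn : 0 < ‖e‖ := norm_pos_iff.2 he0
    obtain ⟨h1, h2⟩ := hA (((‖e‖⁻¹ : ℝ) : ℂ) • e) (by
      rw [norm_smul, norm_real, norm_inv, norm_norm, inv_mul_cancel₀ hn.ne'])
    have hform : inner ℂ e (Matrix.toEuclideanLin A e) = form A x x := by
      simp [form, he, EuclideanSpace.inner_eq_star_dotProduct, dotProduct_comm]
    have hs : inner ℂ ((((‖e‖⁻¹ : ℝ) : ℂ)) • e)
        (Matrix.toEuclideanLin A ((((‖e‖⁻¹ : ℝ) : ℂ)) • e))
        = ((‖e‖⁻¹ ^ 2 : ℝ) : ℂ) * form A x x := by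
      rw [map_smul, inner_smul_left, inner_smul_right, hform, conj_ofReal]
      push_cast
      ring
    rw [hs, re_ofReal_mul] at h1 h2
    rw [im_ofReal_mul] at h2
    have hp : 0 < ‖e‖⁻¹ ^ 2 := by positivity
    refine ⟨pos_of_mul_pos_right h1 hp.le, ?_⟩
    rw [abs_mul, abs_of_pos hp, mul_left_comm] at h2
    exact le_of_mul_le_mul_left h2 hp
  refine ⟨fun x hx => (key x hx).1, fun x => ?_⟩
  by_cases hx : x = 0
  · simp [hx, form]
  · exact (key x hx).2

variable {K L u v y w} {τ : ℝ}

theorem IsSectorialForm.re_nonneg (hK : IsSectorialForm τ K) (x : Fin n → ℂ) :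
    0 ≤ (form K x x).re := by
  by_cases hx : x = 0
  · simp [hx, form]
  · exact (hK.re_pos x hx).le

theorem IsSectorialForm.isUnit_det (hK : IsSectorialForm τ K) : IsUnit K.det := by
  rw [isUnit_iff_ne_zero]
  intro h
  obtain ⟨v, hv, h0⟩ := Matrix.exists_mulVec_eq_zero_iff.2 h
  have := hK.re_pos v hv
  simp [form, h0] at this

/-- Inversion only conjugates the values of the form, and the sector is symmetric under conjugation;
hence `IsSectorialForm.inv`. -/
theorem form_inv_self (hK : IsUnit K.det) (x : Fin n → ℂ) :
    form K⁻¹ x x = star (form K (K⁻¹.mulVec x) (K⁻¹.mulVec x)) := by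
  unfold form
  rw [Matrix.mulVec_mulVec, Matrix.mul_nonsing_inv _ hK, Matrix.one_mulVec]
  simp [dotProduct, mul_comm]

theorem IsSectorialForm.inv (hK : IsSectorialForm τ K) : IsSectorialForm τ K⁻¹ := by
  have hu := hK.isUnit_det
  refine ⟨fun x hx => ?_, fun x => ?_⟩
  · rw [form_inv_self hu]
    refine (hK.re_pos (K⁻¹.mulVec x) fun h => hx ?_).trans_eq (by simp)
    have := congrArg K.mulVec h
    rwa [Matrix.mulVec_mulVec, Matrix.mul_nonsing_inv _ hu, Matrix.one_mulVec,
      Matrix.mulVec_zero] at this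
  · rw [form_inv_self hu]
    simpa using hK.abs_im_le (K⁻¹.mulVec x)

theorem IsSectorialForm.convex (hK : IsSectorialForm τ K) (hL : IsSectorialForm τ L) {s : ℝ}
    (hs : s ∈ Icc (0 : ℝ) 1) : IsSectorialForm τ ((1 - s) • K + s • L) := by
  have h1 : 0 ≤ 1 - s := by linarith [hs.2]
  refine ⟨fun x hx => ?_, fun x => ?_⟩
  · have a := hK.re_pos x hx
    have b := hL.re_pos x hx
    rw [form_add, add_re, form_re_real_smul, form_re_real_smul]
    rcases hs.1.eq_or_lt with h | h
    · rw [← h]; simpa using a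
    · exact add_pos_of_nonneg_of_pos (mul_nonneg h1 a.le) (mul_pos h b)
  · have a := abs_le.1 (hK.abs_im_le x)
    have b := abs_le.1 (hL.abs_im_le x)
    rw [form_add, add_re, add_im, form_real_smul, form_real_smul, re_ofReal_mul, re_ofReal_mul,
      im_ofReal_mul, im_ofReal_mul, abs_le]
    constructor
    · nlinarith [mul_le_mul_of_nonneg_left a.1 h1, mul_le_mul_of_nonneg_left b.1 hs.1]
    · nlinarith [mul_le_mul_of_nonneg_left a.2 h1, mul_le_mul_of_nonneg_left b.2 hs.1]

/-- Polarization: the imaginary part of the form at `w ± k I u` contains `±k` times the left side.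
Combining the upper sector bound at `+k` with the lower one at `-k` cancels all other cross terms
and `Im` terms; then `k = τ` is the right scale. -/
theorem IsSectorialForm.skew_le (hK : IsSectorialForm τ K) (hτ : 0 ≤ τ) (u w : Fin n → ℂ) :
    (form K u w).re - (form K w u).re ≤ τ ^ 2 * (form K u u).re + (form K w w).re := by
  have pol : ∀ k : ℝ, k * ((form K u w).re - (form K w u).re)
      ≤ τ * ((form K w w).re + k ^ 2 * (form K u u).re) := by
    intro k
    have e : ∀ k : ℝ, form K (w + (k * I) • u) (w + (k * I) • u)
        = form K w w + k ^ 2 * form K u u + k * I * (form K u w - form K w u) := fun k => by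
      simp only [form_add_left, form_add_right, form_smul_left, form_smul_right]
      simp only [star_def, map_mul, conj_ofReal, conj_I]
      linear_combination (-(k : ℂ) ^ 2 * form K u u) * I_sq
    have a := (abs_le.1 (hK.abs_im_le (w + (k * I) • u))).2
    have b := (abs_le.1 (hK.abs_im_le (w + ((-k : ℝ) * I) • u))).1
    rw [e k] at a
    rw [e (-k)] at b
    simp [← ofReal_pow] at a b
    nlinarith
  rcases hτ.eq_or_lt with h | h
  -- For `τ = 0` the choice `k = τ` is void; `k = 1` already makes the left side nonpositive.
  · have := pol 1
    rw [← h] at this ⊢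
    have := hK.re_nonneg w
    nlinarith
  · refine le_of_mul_le_mul_left ((pol τ).trans_eq ?_) h
    ring

/-- For positive definite `K` this is `0 ≤ ⟨K(u - y), u - y⟩`. Writing `y = u + w` reduces the
general case to `skew_le`, which pays for the skew part with the extra `τ²`. -/
theorem IsSectorialForm.two_re_le (hK : IsSectorialForm τ K) (hτ : 0 ≤ τ) (u y : Fin n → ℂ) :
    2 * (form K u y).re ≤ (1 + τ ^ 2) * (form K u u).re + (form K y y).re := by
  obtain ⟨w, rfl⟩ : ∃ w, y = u + w := ⟨y - u, by abel⟩
  have := hK.skew_le hτ u w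
  simp only [form_add_left, form_add_right, add_re]
  linarith

theorem IsSectorialForm.two_re_le' (hK : IsSectorialForm τ K) (hτ : 0 ≤ τ) (u y : Fin n → ℂ) :
    2 * (form K u y).re ≤ (form K u u).re + (1 + τ ^ 2) * (form K y y).re := by
  -- Rescaling `u` by `σ⁻¹` and `y` by `σ` keeps the cross term and moves the factor `1 + τ²` to the
  -- other square.
  set σ := Real.sqrt (1 + τ ^ 2) with hσ
  have hσ2 : σ ^ 2 = 1 + τ ^ 2 := Real.sq_sqrt (by positivity)
  have hσ0 : 0 < σ := Real.sqrt_pos.2 (by positivity)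
  have := hK.two_re_le hτ (((σ⁻¹ : ℝ) : ℂ) • u) ((σ : ℂ) • y)
  simp only [form_smul_left, form_smul_right, star_def, conj_ofReal, re_ofReal_mul] at this
  rw [← hσ2] at this ⊢
  have e1 : σ * (σ⁻¹ * (form K u y).re) = (form K u y).re := by field_simp
  have e2 : σ ^ 2 * (σ⁻¹ * (σ⁻¹ * (form K u u).re)) = (form K u u).re := by field_simp
  rw [e1, e2] at this
  linarith

/-! ### Harmonic means of sectorial matrices -/

variable {A B : Matrix (Fin n) (Fin n) ℂ}

/-- Here `⟨Bv,v⟩ = z ⟨Av,v⟩` with both values in the open right half plane, so `z` cannot be real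
and nonpositive. The pairs `(1, A)` and `(A, B)` control the spectra of `A` and `A⁻¹B`. -/
theorem mem_slitPlane_of_smul_mulVec_eq (hA : IsSectorialForm τ A) (hB : IsSectorialForm τ B)
    {z : ℂ} {v : Fin n → ℂ} (hv : v ≠ 0) (h : B.mulVec v = z • A.mulVec v) : z ∈ slitPlane := by
  have hf : form B v v = z * form A v v := by simp [form, h]
  have a := hA.re_pos v hv
  have b := hB.re_pos v hv
  by_contra hz
  rw [mem_slitPlane_iff, not_or, not_lt, not_not] at hz
  rw [hf, mul_re, hz.2] at b
  nlinarith [mul_nonpos_of_nonpos_of_nonneg hz.1 a.le]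

theorem isSectorialForm_one (hτ : 0 ≤ τ) : IsSectorialForm τ (1 : Matrix (Fin n) (Fin n) ℂ) := by
  have e : ∀ x : Fin n → ℂ, form (1 : Matrix (Fin n) (Fin n) ℂ) x x
      = ((∑ i, ‖x i‖ ^ 2 : ℝ) : ℂ) := fun x => by
    simp [form, dotProduct, conj_mul']
  refine ⟨fun x hx => ?_, fun x => ?_⟩
  · rw [e, ofReal_re]
    obtain ⟨i, hi⟩ := Function.ne_iff.1 hx
    exact Finset.sum_pos' (fun i _ => by positivity)
      ⟨i, Finset.mem_univ i, pow_pos (norm_pos_iff.2 hi) 2⟩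
  · rw [e, ofReal_re, ofReal_im, abs_zero]
    positivity

theorem exists_mulVec_eq_of_mem_spectrum {z : ℂ} (hz : z ∈ spectrum ℂ K) :
    ∃ v : Fin n → ℂ, v ≠ 0 ∧ K.mulVec v = z • v := by
  rw [spectrum.mem_iff, Algebra.algebraMap_eq_smul_one, Matrix.isUnit_iff_isUnit_det,
    isUnit_iff_ne_zero, not_not] at hz
  obtain ⟨v, hv, h0⟩ := Matrix.exists_mulVec_eq_zero_iff.2 hz
  rw [Matrix.sub_mulVec, Matrix.smul_mulVec, Matrix.one_mulVec, sub_eq_zero] at h0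
  exact ⟨v, hv, h0.symm⟩

theorem IsSectorialForm.isRegularPair (hA : IsSectorialForm τ A) (hB : IsSectorialForm τ B)
    (hτ : 0 ≤ τ) : IsRegularPair A B := by
  refine ⟨(Matrix.isUnit_iff_isUnit_det _).2 hA.isUnit_det, fun z hz => ?_, fun z hz => ?_⟩
  · obtain ⟨v, hv, h⟩ := exists_mulVec_eq_of_mem_spectrum hz
    exact mem_slitPlane_of_smul_mulVec_eq (isSectorialForm_one hτ) hA hv (by simpa using h)
  · obtain ⟨v, hv, h⟩ := exists_mulVec_eq_of_mem_spectrum hz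
    refine mem_slitPlane_of_smul_mulVec_eq hA hB hv ?_
    rw [← Matrix.mulVec_smul, ← h, Matrix.mulVec_mulVec, ← mul_assoc,
      Matrix.mul_nonsing_inv _ hA.isUnit_det, one_mul]

/-- Let `F` be the kernel evaluated at `X = A⁻¹B` and `q(z) = (1 - s) z + s`. Then `F q(X) = X` and
`q(X) B⁻¹ = (1 - s) A⁻¹ + s B⁻¹`, so `A F` is a left inverse of the latter. -/
theorem mean_harm (hAB : IsRegularPair A B) (hB : IsUnit B.det) {s : ℝ}
    (hs : s ∈ Icc (0 : ℝ) 1) :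
    mean (fun z => z / ((1 - s) * z + s)) A B = harmMean s A B := by
  have hA := (Matrix.isUnit_iff_isUnit_det _).1 hAB.isUnit
  have hd : DifferentiableOn ℂ (fun z : ℂ => z / ((1 - s) * z + s)) slitPlane := fun z hz =>
    (hasDerivAt_harm hs hz).differentiableAt.differentiableWithinAt
  rw [mean_eq hAB.isUnit hAB.spectrum_left hAB.spectrum_quot hd]
  set X := A⁻¹ * B with hX
  set F := matFun (fun z : ℂ => z / ((1 - s) * z + s)) X with hF
  set q : Polynomial ℂ := Polynomial.C (1 - s : ℂ) * Polynomial.X + Polynomial.C (s : ℂ) with hq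
  have h1 : F * Polynomial.aeval X q = X := by
    rw [hF, ← matFun_eval hAB.spectrum_quot, ← matFun_mul hAB.spectrum_quot hd
      q.differentiable.differentiableOn,
      matFun_congr hAB.spectrum_quot (g := fun z => Polynomial.X.eval z),
      matFun_eval hAB.spectrum_quot, Polynomial.aeval_X]
    intro z hz
    have := slitPlane_ne_zero (harm_den_mem_slitPlane hs hz)
    simp only [hq, Polynomial.eval_add, Polynomial.eval_mul, Polynomial.eval_C, Polynomial.eval_X]
    exact div_mul_cancel₀ z this
  have h2 : Polynomial.aeval X q * B⁻¹ = (1 - s) • A⁻¹ + s • B⁻¹ := by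
    have e1 : ∀ (a : ℝ) (M : Matrix (Fin n) (Fin n) ℂ), a • M = (a : ℂ) • M := fun a M => by
      ext i j; simp
    rw [hq, e1, e1]
    simp only [map_add, map_mul, Polynomial.aeval_C, Polynomial.aeval_X,
      Algebra.algebraMap_eq_smul_one, smul_mul_assoc, one_mul, add_mul]
    rw [hX, mul_assoc, Matrix.mul_nonsing_inv _ hB, mul_one]
    push_cast
    rfl
  unfold harmMean
  symm
  refine Matrix.inv_eq_left_inv ?_
  rw [← h2, mul_assoc, ← mul_assoc F, h1, hX, ← mul_assoc, ← mul_assoc,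
    Matrix.mul_nonsing_inv _ hA, one_mul, Matrix.mul_nonsing_inv _ hB]

theorem IsSectorialForm.harmMean_le (hA : IsSectorialForm τ A) (hB : IsSectorialForm τ B)
    (hτ : 0 ≤ τ) {s : ℝ} (hs : s ∈ Icc (0 : ℝ) 1) (x : Fin n → ℂ) :
    (form (harmMean s A B) x x).re
      ≤ (1 + τ ^ 2) * ((1 - s) * (form A x x).re + s * (form B x x).re) := by
  have hAu := hA.isUnit_det
  have hBu := hB.isUnit_det
  have hKu := (hA.inv.convex hB.inv hs).isUnit_det
  -- The harmonic mean sends `x` to `u = Av = Bw` with `x = (1 - s) v + s w`. Adding `two_re_le'`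
  -- for `(v, x)` and `(w, x)` with these weights, one of the two copies of `Re⟨u,x⟩` cancels.
  set K := (1 - s) • A⁻¹ + s • B⁻¹ with hK
  set u := K⁻¹.mulVec x with hu
  set v := A⁻¹.mulVec u with hv
  set w := B⁻¹.mulVec u with hw
  have hx : x = (1 - s) • v + s • w := by
    have : K.mulVec u = x := by
      rw [hu, Matrix.mulVec_mulVec, Matrix.mul_nonsing_inv _ hKu, Matrix.one_mulVec]
    rw [← this, hK, Matrix.add_mulVec, Matrix.smul_mulVec, Matrix.smul_mulVec]
  have hAv : A.mulVec v = u := by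
    rw [hv, Matrix.mulVec_mulVec, Matrix.mul_nonsing_inv _ hAu, Matrix.one_mulVec]
  have hBw : B.mulVec w = u := by
    rw [hw, Matrix.mulVec_mulVec, Matrix.mul_nonsing_inv _ hBu, Matrix.one_mulVec]
  have e0 : form (harmMean s A B) x x = star x ⬝ᵥ u := rfl
  have e1 : (star x ⬝ᵥ u).re = (1 - s) * (form A v v).re + s * (form B w w).re := by
    unfold form
    rw [hAv, hBw]
    conv_lhs => rw [hx]
    simp [star_add, add_dotProduct, smul_dotProduct]
  have a := hA.two_re_le' hτ v x
  have b := hB.two_re_le' hτ w x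
  have ea : form A v x = star x ⬝ᵥ u := by rw [form, hAv]
  have eb : form B w x = star x ⬝ᵥ u := by rw [form, hBw]
  rw [ea] at a
  rw [eb] at b
  rw [e0]
  have h1 : 0 ≤ 1 - s := by linarith [hs.2]
  nlinarith [mul_le_mul_of_nonneg_left a h1, mul_le_mul_of_nonneg_left b hs.1]

/-- Apply `two_re_le` to `K s` with the fixed test vector `y = (K t)⁻¹ x`: the cross term is
independent of `s` and `⟨(K s) y, y⟩` is affine in `s`. The constant `C` is minus its real slope, so
it does not depend on `s` and the bound can be averaged. -/
theorem IsSectorialForm.le_harmMean (hA : IsSectorialForm τ A) (hB : IsSectorialForm τ B)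
    (hτ : 0 ≤ τ) {t : ℝ} (ht : t ∈ Icc (0 : ℝ) 1) (x : Fin n → ℂ) :
    ∃ C : ℝ, ∀ s ∈ Icc (0 : ℝ) 1, (form (harmMean t A B) x x).re + (s - t) * C
      ≤ (1 + τ ^ 2) * (form (harmMean s A B) x x).re := by
  set K : ℝ → Matrix (Fin n) (Fin n) ℂ := fun s => (1 - s) • A⁻¹ + s • B⁻¹ with hK
  set y := (K t)⁻¹.mulVec x with hy
  have hsec : ∀ s ∈ Icc (0 : ℝ) 1, IsSectorialForm τ (K s) := fun s hs => hA.inv.convex hB.inv hs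
  have hmul : ∀ s ∈ Icc (0 : ℝ) 1, (K s).mulVec ((K s)⁻¹.mulVec x) = x := fun s hs => by
    rw [Matrix.mulVec_mulVec, Matrix.mul_nonsing_inv _ (hsec s hs).isUnit_det, Matrix.one_mulVec]
  have hself : ∀ s ∈ Icc (0 : ℝ) 1, (form (harmMean s A B) x x).re
      = (form (K s) ((K s)⁻¹.mulVec x) ((K s)⁻¹.mulVec x)).re := fun s hs => by
    have := form_inv_self (hsec s hs).isUnit_det x
    rw [show harmMean s A B = (K s)⁻¹ from rfl, this]
    simp
  refine ⟨-((form B⁻¹ y y).re - (form A⁻¹ y y).re), fun s hs => ?_⟩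
  have h1 := (hsec s hs).two_re_le hτ ((K s)⁻¹.mulVec x) y
  rw [← hself s hs] at h1
  have h2 : form (K s) ((K s)⁻¹.mulVec x) y = form (K t) y y := by
    unfold form
    rw [hmul s hs, hy, hmul t ht]
  have h3 : (form (K s) y y).re
      = (form (K t) y y).re + (s - t) * ((form B⁻¹ y y).re - (form A⁻¹ y y).re) := by
    simp only [hK, form_add, add_re, form_re_real_smul]
    ring
  rw [h2, h3] at h1
  rw [hself t ht]
  linarith

end

/-! ### Integral representations of the means -/

section

variable {n : ℕ} {A B : Matrix (Fin n) (Fin n) ℂ} {τ : ℝ}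

theorem logMean_eq_integral (hAB : IsRegularPair A B) {t : ℝ} (ht₀ : 0 < t) (ht₁ : t < 1)
    (i j : Fin n) : Integrable (fun p => geomMean p A B i j) (expMeasure t) ∧
      logMean t A B i j = ∫ p, geomMean p A B i j ∂(expMeasure t) :=
  mean_integral hAB (ae_expMeasure_Icc ht₀ ht₁) continuousOn_cpow continuousOn_cpow_deriv
    (fun p _ _ hz => hasDerivAt_cpow p hz) (fun _ hz => logFunC_eq_integral ht₀ ht₁ hz) i j

/-- The weighted geometric mean is an average of weighted harmonic means. -/
theorem exists_geomMean_eq_integral (hAB : IsRegularPair A B) (hB : IsUnit B.det) {p : ℝ}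
    (hp : p ∈ Ioo (0 : ℝ) 1) :
    ∃ ν : Measure ℝ, IsProbabilityMeasure ν ∧ (∀ᵐ s ∂ν, s ∈ Icc (0 : ℝ) 1) ∧ ∫ s, s ∂ν = p ∧
      ∀ i j, Integrable (fun s => harmMean s A B i j) ν ∧
        geomMean p A B i j = ∫ s, harmMean s A B i j ∂ν := by
  obtain ⟨ν, hpr, hν, hmean, hz⟩ := exists_measure_cpow hp
  refine ⟨ν, hpr, hν, hmean, fun i j => ?_⟩
  have hm := mean_integral hAB hν continuousOn_harm continuousOn_harm_deriv
    (fun s hs z hz => hasDerivAt_harm hs hz) hz i j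
  have he : ∀ᵐ s : ℝ ∂ν, mean (fun z => z / ((1 - s) * z + s)) A B i j = harmMean s A B i j := by
    filter_upwards [hν] with s hs
    rw [mean_harm hAB hB hs]
  exact ⟨hm.1.congr he, hm.2.trans (integral_congr_ae he)⟩

theorem re_form_integral {ν : Measure ℝ} {M : ℝ → Matrix (Fin n) (Fin n) ℂ}
    {N : Matrix (Fin n) (Fin n) ℂ}
    (h : ∀ i j, Integrable (fun s => M s i j) ν ∧ N i j = ∫ s, M s i j ∂ν) (x : Fin n → ℂ) :
    Integrable (fun s => (form (M s) x x).re) ν ∧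
      (form N x x).re = ∫ s, (form (M s) x x).re ∂ν := by
  have hi : ∀ i j, Integrable (fun s => star x i * (M s i j * x j)) ν := fun i j =>
    ((h i j).1.mul_const _).const_mul _
  have hij : ∀ i, Integrable (fun s => ∑ j, star x i * (M s i j * x j)) ν := fun i =>
    integrable_finsetSum _ fun j _ => hi i j
  have hs : Integrable (fun s => form (M s) x x) ν := by
    simp only [form, dotProduct, Matrix.mulVec, Finset.mul_sum]
    exact integrable_finsetSum _ fun i _ => hij i
  refine ⟨hs.re, ?_⟩
  have e : form N x x = ∫ s, form (M s) x x ∂ν := by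
    simp only [form, dotProduct, Matrix.mulVec, Finset.mul_sum]
    rw [integral_finsetSum _ fun i _ => hij i]
    refine Finset.sum_congr rfl fun i _ => ?_
    rw [integral_finsetSum _ fun j _ => hi i j]
    refine Finset.sum_congr rfl fun j _ => ?_
    rw [integral_const_mul, integral_mul_const, (h i j).2]
  rw [e]
  exact (integral_re hs).symm

theorem integral_affine {ν : Measure ℝ} [IsProbabilityMeasure ν]
    (hν : ∀ᵐ s ∂ν, s ∈ Icc (0 : ℝ) 1) (a b : ℝ) :
    Integrable (fun s => a + s * b) ν ∧ ∫ s, (a + s * b) ∂ν = a + (∫ s, s ∂ν) * b := by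
  have hi : Integrable (fun s : ℝ => s) ν := integrable_of_continuousOn_Icc hν continuousOn_id
  refine ⟨(integrable_const a).add (hi.mul_const b), ?_⟩
  rw [integral_add (integrable_const a) (hi.mul_const b), integral_mul_const]
  simp

/-- Affine bounds in the parameter pass to averages. -/
theorem affine_bounds_of_integral {ν : Measure ℝ} [IsProbabilityMeasure ν]
    (hν : ∀ᵐ s ∂ν, s ∈ Icc (0 : ℝ) 1) {M : ℝ → Matrix (Fin n) (Fin n) ℂ}
    {N : Matrix (Fin n) (Fin n) ℂ}
    (h : ∀ i j, Integrable (fun s => M s i j) ν ∧ N i j = ∫ s, M s i j ∂ν) {x : Fin n → ℂ}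
    {a b c d k : ℝ}
    (hbd : ∀ᵐ s ∂ν, a + s * b ≤ k * (form (M s) x x).re ∧ (form (M s) x x).re ≤ c + s * d) :
    a + (∫ s, s ∂ν) * b ≤ k * (form N x x).re ∧ (form N x x).re ≤ c + (∫ s, s ∂ν) * d := by
  obtain ⟨hi, he⟩ := re_form_integral h x
  obtain ⟨i1, e1⟩ := integral_affine hν a b
  obtain ⟨i2, e2⟩ := integral_affine hν c d
  rw [he, ← e1, ← e2, ← integral_const_mul]
  exact ⟨integral_mono_ae i1 (hi.const_mul k) (hbd.mono fun _ hs => hs.1),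
    integral_mono_ae hi i2 (hbd.mono fun _ hs => hs.2)⟩

/-- The measure for exponent `p` has mean `p`, so averaging replaces `s` by `p`. As `C` precedes
`p`, the bounds remain affine in `p` and can be averaged again for the logarithmic mean. -/
theorem geomMean_bounds (hA : IsSectorialForm τ A) (hB : IsSectorialForm τ B) (hτ : 0 ≤ τ)
    {t : ℝ} (ht : t ∈ Icc (0 : ℝ) 1) (x : Fin n → ℂ) :
    ∃ C : ℝ, ∀ p ∈ Ioo (0 : ℝ) 1,
      (form (harmMean t A B) x x).re - t * C + p * C
          ≤ (1 + τ ^ 2) * (form (geomMean p A B) x x).re ∧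
        (form (geomMean p A B) x x).re
          ≤ (1 + τ ^ 2) * (form A x x).re
            + p * ((1 + τ ^ 2) * ((form B x x).re - (form A x x).re)) := by
  obtain ⟨C, hC⟩ := hA.le_harmMean hB hτ ht x
  refine ⟨C, fun p hp => ?_⟩
  obtain ⟨ν, hpr, hν, hmean, hM⟩ :=
    exists_geomMean_eq_integral (hA.isRegularPair hB hτ) hB.isUnit_det hp
  have hbd : ∀ᵐ s ∂ν, (form (harmMean t A B) x x).re - t * C + s * C
        ≤ (1 + τ ^ 2) * (form (harmMean s A B) x x).re ∧
      (form (harmMean s A B) x x).re ≤ (1 + τ ^ 2) * (form A x x).re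
        + s * ((1 + τ ^ 2) * ((form B x x).re - (form A x x).re)) := by
    filter_upwards [hν] with s hs
    constructor
    · linarith [hC s hs]
    · linarith [hA.harmMean_le hB hτ hs x]
  have := affine_bounds_of_integral hν hM hbd
  rwa [hmean] at this

theorem geomMean_bounds_self (hA : IsSectorialForm τ A) (hB : IsSectorialForm τ B)
    (hτ : 0 ≤ τ) {t : ℝ} (ht : t ∈ Ioo (0 : ℝ) 1) (x : Fin n → ℂ) :
    (form (harmMean t A B) x x).re ≤ (1 + τ ^ 2) * (form (geomMean t A B) x x).re ∧
      (form (geomMean t A B) x x).re ≤ (1 + τ ^ 2) * (form (arithMean t A B) x x).re := by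
  obtain ⟨C, hC⟩ := geomMean_bounds hA hB hτ (Ioo_subset_Icc_self ht) x
  have := hC t ht
  unfold arithMean
  rw [form_add, add_re, form_re_real_smul, form_re_real_smul]
  constructor <;> linarith

/-- The second averaging, over `expMeasure t`: its mean is `t`, where the term with `C` vanishes. -/
theorem logMean_bounds (hA : IsSectorialForm τ A) (hB : IsSectorialForm τ B)
    (hτ : 0 ≤ τ) {t : ℝ} (ht : t ∈ Ioo (0 : ℝ) 1) (x : Fin n → ℂ) :
    (form (harmMean t A B) x x).re ≤ (1 + τ ^ 2) * (form (logMean t A B) x x).re ∧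
      (form (logMean t A B) x x).re ≤ (1 + τ ^ 2) * (form (arithMean t A B) x x).re := by
  have hpr := isProbabilityMeasure_expMeasure ht.1 ht.2
  obtain ⟨C, hC⟩ := geomMean_bounds hA hB hτ (Ioo_subset_Icc_self ht) x
  have := affine_bounds_of_integral (ae_expMeasure_Icc ht.1 ht.2)
    (logMean_eq_integral (hA.isRegularPair hB hτ) ht.1 ht.2)
    ((ae_expMeasure ht.1 ht.2).mono hC)
  rw [integral_id_expMeasure ht.1 ht.2] at this
  unfold arithMean
  rw [form_add, add_re, form_re_real_smul, form_re_real_smul]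
  constructor <;> linarith

/-! ### The Loewner order -/

theorem matRe_eq (M : Matrix (Fin n) (Fin n) ℂ) :
    matRe M = (2⁻¹ : ℝ) • (M + M.conjTranspose) := by
  unfold matRe
  rw [realPart_apply_coe, Matrix.star_eq_conjTranspose]

theorem form_conjTranspose (M : Matrix (Fin n) (Fin n) ℂ) (x : Fin n → ℂ) :
    form M.conjTranspose x x = star (form M x x) := by
  unfold form
  rw [Matrix.star_dotProduct, Matrix.star_mulVec, Matrix.dotProduct_mulVec,
    Matrix.conjTranspose_conjTranspose]

theorem form_matRe (M : Matrix (Fin n) (Fin n) ℂ) (x : Fin n → ℂ) :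
    form (matRe M) x x = ((form M x x).re : ℂ) := by
  rw [matRe_eq, form_real_smul, form_add, form_conjTranspose, star_def, add_conj]
  push_cast
  ring

theorem isHermitian_matRe (M : Matrix (Fin n) (Fin n) ℂ) : (matRe M).IsHermitian :=
  (realPart M).2

theorem isHermitian_real_smul {M : Matrix (Fin n) (Fin n) ℂ} (hM : M.IsHermitian) (a : ℝ) :
    (a • M).IsHermitian := by
  unfold Matrix.IsHermitian
  rw [Matrix.conjTranspose_smul, hM.eq, star_trivial]

theorem le_of_form_re_le {M N : Matrix (Fin n) (Fin n) ℂ} (hM : M.IsHermitian)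
    (hN : N.IsHermitian) (h : ∀ x, (form M x x).re ≤ (form N x x).re) : M ≤ N := by
  have hd := hN.sub hM
  rw [Matrix.le_iff, Matrix.posSemidef_iff_dotProduct_mulVec]
  refine ⟨hd, fun x => ?_⟩
  change 0 ≤ form (N - M) x x
  have him : (form (N - M) x x).im = 0 := by
    have := form_conjTranspose (N - M) x
    rw [hd.eq] at this
    exact conj_eq_iff_im.1 this.symm
  rw [Complex.le_def]
  refine ⟨?_, by simpa using him.symm⟩
  rw [form_sub, sub_re, zero_re]
  linarith [h x]

/-! ### Matrix monotonicity -/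

theorem form_re_mono {M N : Matrix (Fin n) (Fin n) ℂ} (h : M ≤ N) (x : Fin n → ℂ) :
    (form M x x).re ≤ (form N x x).re := by
  have h0 : 0 ≤ form (N - M) x x := (Matrix.le_iff.1 h).dotProduct_mulVec_nonneg x
  have := (Complex.le_def.1 h0).1
  rw [form_sub, sub_re, zero_re] at this
  linarith

open scoped Matrix.Norms.L2Operator in
theorem cfc_rpow_le_cfc_rpow {P Q : Matrix (Fin n) (Fin n) ℂ} (hP : P.PosDef) (hQ : Q.PosDef)
    (h : P ≤ Q) {p : ℝ} (hp : p ∈ Icc (0 : ℝ) 1) :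
    cfc (fun x : ℝ => x ^ p) P ≤ cfc (fun x : ℝ => x ^ p) Q := by
  have := CFC.rpow_le_rpow hp h
  rwa [CFC.rpow_eq_cfc_real hP.posSemidef.nonneg, CFC.rpow_eq_cfc_real hQ.posSemidef.nonneg]
    at this

/-- Entries of `cfc f P` are linear in the values of `f` on the spectrum, so integrals over a
parameter of `f` pass through. -/
theorem cfc_apply_eq_sum {P : Matrix (Fin n) (Fin n) ℂ} (hP : P.IsHermitian) (f : ℝ → ℝ)
    (i j : Fin n) : cfc f P i j = ∑ k, (f (hP.eigenvalues k) : ℂ) *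
      ((hP.eigenvectorUnitary : Matrix (Fin n) (Fin n) ℂ) i k
        * star ((hP.eigenvectorUnitary : Matrix (Fin n) (Fin n) ℂ) j k)) := by
  rw [hP.cfc_eq, Matrix.IsHermitian.cfc, Unitary.conjStarAlgAut_apply, Matrix.mul_apply]
  refine Finset.sum_congr rfl fun k _ => ?_
  rw [Matrix.mul_diagonal]
  simp [Matrix.star_apply]
  ring

/-- An average of the Löwner–Heinz inequalities for `x ^ p`, `0 ≤ p ≤ 1`, tested on quadratic forms.
-/
theorem isNormalizedMonotone_logFun {t : ℝ} (ht₀ : 0 < t) (ht₁ : t < 1) :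
    IsNormalizedMonotone (logFun t) := by
  refine ⟨fun x hx => logFun_pos ht₀ ht₁ hx, by simp [logFun], fun k P Q hP hQ hPQ => ?_⟩
  have hrep : ∀ S : Matrix (Fin k) (Fin k) ℂ, S.PosDef → ∀ i j,
      Integrable (fun p : ℝ => cfc (fun x : ℝ => x ^ p) S i j) (expMeasure t) ∧
        cfc (logFun t) S i j = ∫ p, cfc (fun x : ℝ => x ^ p) S i j ∂(expMeasure t) := by
    intro S hS i j
    have hpos := hS.eigenvalues_pos
    have hint : ∀ l, Integrable (fun p : ℝ => ((hS.1.eigenvalues l ^ p : ℝ) : ℂ))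
        (expMeasure t) := fun l =>
      integrable_of_continuousOn_Icc (ae_expMeasure_Icc ht₀ ht₁)
        (continuous_ofReal.comp (Real.continuous_const_rpow (hpos l).ne')).continuousOn
    simp only [cfc_apply_eq_sum hS.1]
    refine ⟨integrable_finsetSum _ fun l _ => (hint l).mul_const _, ?_⟩
    rw [integral_finsetSum _ fun l _ => (hint l).mul_const _]
    refine Finset.sum_congr rfl fun l _ => ?_
    rw [integral_mul_const, integral_complex_ofReal, logFun_eq_integral ht₀ ht₁ (hpos l)]
  refine le_of_form_re_le (cfc_predicate _ P) (cfc_predicate _ Q) fun x => ?_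
  obtain ⟨i1, e1⟩ := re_form_integral (hrep P hP) x
  obtain ⟨i2, e2⟩ := re_form_integral (hrep Q hQ) x
  rw [e1, e2]
  refine integral_mono_ae i1 i2 ?_
  filter_upwards [ae_expMeasure_Icc ht₀ ht₁] with p hp
  exact form_re_mono (cfc_rpow_le_cfc_rpow hP hQ hPQ hp) x

end

end SectorialMean

end

theorem mainTheorem12 (n : ℕ) (α t : ℝ) (hα₀ : 0 ≤ α) (hα₁ : α < Real.pi / 2)
    (ht₀ : 0 < t) (ht₁ : t < 1) (A B : Matrix (Fin n) (Fin n) ℂ)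
    (hA : SectorialMean.IsSectorial α A) (hB : SectorialMean.IsSectorial α B) :
    -- the representing function is matrix monotone and normalized, with derivative `t` at `1`
    SectorialMean.IsNormalizedMonotone (SectorialMean.logFun t) ∧
    HasDerivAt (SectorialMean.logFun t) t 1 ∧
    -- the integral formula for the weighted logarithmic mean
    (∀ i j, SectorialMean.logMean t A B i j =
      ((1 - t) / t) * (∫ p in (0 : ℝ)..t, SectorialMean.geomMean p A B i j) +
      (t / (1 - t)) * (∫ p in t..(1 : ℝ), SectorialMean.geomMean p A B i j)) ∧
    -- the lower bound
    (Real.cos α ^ 2) • SectorialMean.matRe (SectorialMean.harmMean t A B)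
        + SectorialMean.matRe (SectorialMean.geomMean t A B)
        - (1 / Real.cos α ^ 2) • SectorialMean.matRe (SectorialMean.arithMean t A B)
      ≤ SectorialMean.matRe (SectorialMean.logMean t A B) ∧
    -- the upper bound
    SectorialMean.matRe (SectorialMean.logMean t A B)
      ≤ (1 / Real.cos α ^ 2) • SectorialMean.matRe (SectorialMean.arithMean t A B)
        + SectorialMean.matRe (SectorialMean.geomMean t A B)
        - (Real.cos α ^ 2) • SectorialMean.matRe (SectorialMean.harmMean t A B) := by
  have hτ : 0 ≤ Real.tan α := Real.tan_nonneg_of_nonneg_of_le_pi_div_two hα₀ hα₁.le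
  have hcos : 0 < Real.cos α := Real.cos_pos_of_mem_Ioo ⟨by linarith [Real.pi_pos], hα₁⟩
  have hsec : 1 + Real.tan α ^ 2 = 1 / Real.cos α ^ 2 := by
    rw [← Real.inv_one_add_tan_sq hcos.ne', one_div, inv_inv]
  have hA' := hA.isSectorialForm
  have hB' := hB.isSectorialForm
  have hg := SectorialMean.geomMean_bounds_self hA' hB' hτ ⟨ht₀, ht₁⟩
  have hl := SectorialMean.logMean_bounds hA' hB' hτ ⟨ht₀, ht₁⟩
  rw [hsec] at hg hl
  have hmul : ∀ a b : ℝ, a ≤ 1 / Real.cos α ^ 2 * b → Real.cos α ^ 2 * a ≤ b := fun a b h => by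
    rwa [one_div_mul_eq_div, le_div_iff₀' (pow_pos hcos 2)] at h
  have hre := fun M : Matrix (Fin n) (Fin n) ℂ => SectorialMean.isHermitian_matRe M
  have hsm := fun (a : ℝ) (M : Matrix (Fin n) (Fin n) ℂ) =>
    SectorialMean.isHermitian_real_smul (hre M) a
  refine ⟨SectorialMean.isNormalizedMonotone_logFun ht₀ ht₁,
    SectorialMean.hasDerivAt_logFun_one ht₀ ht₁, fun i j => ?_, ?_, ?_⟩
  · obtain ⟨hi, he⟩ :=
      SectorialMean.logMean_eq_integral (hA'.isRegularPair hB' hτ) ht₀ ht₁ i j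
    rw [he, SectorialMean.integral_expMeasure ht₀ ht₁ hi]
    simp
  · refine SectorialMean.le_of_form_re_le (((hsm _ _).add (hre _)).sub (hsm _ _)) (hre _)
      fun x => ?_
    simp only [SectorialMean.form_add, SectorialMean.form_sub, SectorialMean.form_real_smul,
      SectorialMean.form_matRe, Complex.add_re, Complex.sub_re, Complex.re_ofReal_mul,
      Complex.ofReal_re]
    -- Harmonic bound for the logarithmic mean plus arithmetic bound for the geometric mean; the
    -- other inequality swaps the roles.
    linarith [hmul _ _ (hl x).1, (hg x).2]
  · refine SectorialMean.le_of_form_re_le (hre _) (((hsm _ _).add (hre _)).sub (hsm _ _))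
      fun x => ?_
    simp only [SectorialMean.form_add, SectorialMean.form_sub, SectorialMean.form_real_smul,
      SectorialMean.form_matRe, Complex.add_re, Complex.sub_re, Complex.re_ofReal_mul,
      Complex.ofReal_re]
    linarith [hmul _ _ (hg x).1, (hl x).2]
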